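/- Graphs are finite, undirected and simple; a path may consist of a single vertex. A *spanning linkage* in a graph $G$ is a subgraph $L$ of $G$ with $V(L)=V(G)$ every component of which is a path. Its *pattern* is the set of vertices of degree $1$ in $L$ together with their pairing by the paths of $L$, that is, the set of all unordered pairs $\{u,v\}$, $u\neq v$, of vertices of degree $1$ that lie in the same component of $L$. $L$ is a *vital linkage* in $G$ if no other spanning linkage in $G$ has the same pattern as $L$. Tree-width and path-width are the minimum of $\max_t |X_t|-1$ over all tree-decompositions, respectively path-decompositions, $(X_t)_t$ of the graph. Let $f,g:\mathbb{N}\to\mathbb{N}$ be functions such that, for every $k$, every graph that has a vital linkage with exactly $k$ components has tree-width at most $f(k)$ and path-width at most $g(k)$. Then for every $k\ge 2$ $$2^{k-1}+1\le f(k)\qquad\text{and}\qquad 2^{k-1}+1\le g(k).$$ -/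

import Mathlib

namespace VitalLinkage

/-- A graph that is a path, possibly with a single vertex. -/
def IsPathGraph {V : Type*} (G : SimpleGraph V) : Prop :=
  ∃ n : ℕ, 1 ≤ n ∧ Nonempty (G ≃g SimpleGraph.pathGraph n)

/-- A tree-decomposition `(T, (X_t)_{t ∈ ι})` of `G`: a finite tree `T` on the index set `ι` and
a bag `X_t ⊆ V(G)` for every node `t`. -/
structure TreeDecomposition {V : Type*} (G : SimpleGraph V) (ι : Type) where
  tree : SimpleGraph ι
  finite : Finite ι
  isTree : tree.IsTree
  bag : ι → Set V
  /-- Every vertex lies in some bag. -/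
  vertex_mem : ∀ v : V, ∃ t, v ∈ bag t
  /-- Both ends of every edge lie in a common bag. -/
  edge_mem : ∀ u v : V, G.Adj u v → ∃ t, u ∈ bag t ∧ v ∈ bag t
  /-- If `j` lies on the path of the tree from `i` to `l`, then `X_i ∩ X_l ⊆ X_j`. -/
  inter_subset : ∀ (i j l : ι) (p : tree.Walk i l), p.IsPath → j ∈ p.support →
    bag i ∩ bag l ⊆ bag j

/-- The decomposition has width at most `w`: every bag has at most `w + 1` vertices. -/
def TreeDecomposition.WidthLE {V : Type*} {G : SimpleGraph V} {ι : Type}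
    (D : TreeDecomposition G ι) (w : ℕ) : Prop :=
  ∀ t, (D.bag t).Finite ∧ (D.bag t).ncard ≤ w + 1

/-- The tree-width of a finite graph: the least width of a tree-decomposition
(`0` for the graph without vertices). -/
noncomputable def treeWidth {V : Type*} (G : SimpleGraph V) : ℕ :=
  sInf {w | ∃ (ι : Type) (D : TreeDecomposition G ι), D.WidthLE w}

/-- The path-width of a finite graph: the least width of a path-decomposition, that is, of a
tree-decomposition whose tree is a path (`0` for the graph without vertices). -/
noncomputable def pathWidth {V : Type*} (G : SimpleGraph V) : ℕ :=
  sInf {w | ∃ (ι : Type) (D : TreeDecomposition G ι), IsPathGraph D.tree ∧ D.WidthLE w}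

/-- The decomposition with a single bag. It shows that, for a finite graph, the sets in the
definitions of tree-width and path-width are non-empty. -/
def trivialDecomposition {V : Type*} (G : SimpleGraph V) : TreeDecomposition G (Fin 1) where
  tree := SimpleGraph.pathGraph 1
  finite := inferInstance
  isTree := ⟨SimpleGraph.pathGraph_connected 0, fun v p hp => by
    have h := p.adj_snd hp.not_nil
    exact h.ne (Subsingleton.elim _ _)⟩
  bag := fun _ => Set.univ
  vertex_mem := fun _ => ⟨0, trivial⟩
  edge_mem := fun _ _ _ => ⟨0, trivial, trivial⟩
  inter_subset := fun _ _ _ _ _ _ _ _ => trivial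

theorem exists_pathDecomposition {V : Type*} [Finite V] (G : SimpleGraph V) :
    ∃ (w : ℕ) (ι : Type) (D : TreeDecomposition G ι), IsPathGraph D.tree ∧ D.WidthLE w :=
  ⟨(Set.univ : Set V).ncard, Fin 1, trivialDecomposition G,
    ⟨1, le_rfl, ⟨SimpleGraph.Iso.refl⟩⟩, fun _ => ⟨Set.finite_univ, Nat.le_succ _⟩⟩

/-- `L` is a linkage in `G` that contains all vertices of `G`: a spanning subgraph every component
of which is a path. Spanning subgraphs of `G` are the graphs `L ≤ G` on the same vertex type. -/
def IsSpanningLinkage {V : Type*} (G L : SimpleGraph V) : Prop :=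
  L ≤ G ∧ ∀ C : L.ConnectedComponent, IsPathGraph C.toSimpleGraph

/-- `v` has degree `1` in `L`. -/
def IsEnd {V : Type*} (L : SimpleGraph V) (v : V) : Prop :=
  (L.neighborSet v).ncard = 1

/-- The pattern of a linkage: the vertices of degree `1`, paired by the paths that join them,
as a set of unordered pairs. -/
def pattern {V : Type*} (L : SimpleGraph V) : Set (Sym2 V) :=
  {e | ∃ u v : V, u ≠ v ∧ IsEnd L u ∧ IsEnd L v ∧ L.Reachable u v ∧ e = s(u, v)}

/-- `L` is a vital linkage in `G`: it is the only linkage with its pattern among those that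
contain all vertices of `G`. -/
def IsVitalLinkage {V : Type*} (G L : SimpleGraph V) : Prop :=
  IsSpanningLinkage G L ∧
    ∀ L' : SimpleGraph V, IsSpanningLinkage G L' → pattern L' = pattern L → L' = L

/-- `G` has a vital linkage with exactly `k` components. -/
def HasVitalLinkage {V : Type*} (G : SimpleGraph V) (k : ℕ) : Prop :=
  ∃ L : SimpleGraph V, IsVitalLinkage G L ∧ Nat.card L.ConnectedComponent = k

end VitalLinkage

namespace VitalLinkage

/-! For each `k ≥ 2` there is a planar graph of tree-width at least `2 ^ k - 1` with a vital linkage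
of `k` components. It is a grid with `2 ^ k - 1` rows. Arcs in the last column realise the
reflection `r ↦ 2 ^ k - r`, and arcs in the first column realise `r ↦ 3 * 2 ^ l - r` on each block
`2 ^ l < r < 2 ^ (l + 1)`. The rows and arcs together form the linkage. The reflections preserve the
2-adic valuation of the row, and path `j` runs through all rows of valuation `j`. Its ends are the
left end of row `2 ^ j`, which lies in no block, and an end of a row fixed by a reflection: row `3 *
2 ^ j` on the left or, for the last path, row `2 ^ (k - 1)` on the right.

Uniqueness is a planarity argument. Disjoint walks cannot interlace on the left boundary
(`reachable_of_interlace`); instead of an embedding, the proof uses the parity of the crossings of a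
walk with a ray. Let a linkage have the same pattern. Delete its left arcs level by level. The path
from row `2 ^ p` to row `3 * 2 ^ p` separates the mirror pairs around row `2 ^ p`, so all these rows
must continue into the next block. Noncrossing and counting then force the mirror matching and all
arcs of that block (`Stage.succ`). In the last stage the same separation forces `2 ^ k - 1` disjoint
paths through every column, so all rows and right arcs are used (`Stage.exists_cut`). Degrees
exclude any further edge.

The width bound comes from a bramble of order `2 ^ k` in the grid (`le_width_host`). It also bounds
path-width, since path-decompositions are tree-decompositions. -/

/-- The vertices of the host graph: `2 ^ k - 1` rows, numbered from `1`, and `m` columns. -/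
abbrev Vert (k m : ℕ) : Type := {p : ℕ × ℕ // 0 < p.1 ∧ p.1 < 2 ^ k ∧ p.2 < m}

namespace Vert
variable {k m : ℕ}

/-- The row of a vertex. -/
abbrev row (v : Vert k m) : ℕ := v.1.1

/-- The column of a vertex. -/
abbrev col (v : Vert k m) : ℕ := v.1.2

theorem ext_iff' {v w : Vert k m} : v = w ↔ v.row = w.row ∧ v.col = w.col := by
  rw [Subtype.ext_iff, Prod.ext_iff]

end Vert

/-! ### Edges of the host graph. -/

/-- A horizontal edge of the grid, from left to right. -/
def Hor {k m : ℕ} (x y : Vert k m) : Prop := x.row = y.row ∧ x.col + 1 = y.col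

/-- A vertical edge of the grid. -/
def Ver {k m : ℕ} (x y : Vert k m) : Prop := x.col = y.col ∧ x.row + 1 = y.row

/-- An arc on the right side of the grid. -/
def RArc {k m : ℕ} (x y : Vert k m) : Prop :=
  x.col + 1 = m ∧ y.col + 1 = m ∧ x.row < y.row ∧ x.row + y.row = 2 ^ k

/-- An arc on the left side of the grid, in the block of rows between `2 ^ l` and `2 ^ (l + 1)`. -/
def LArc {k m : ℕ} (l : ℕ) (x y : Vert k m) : Prop :=
  x.col = 0 ∧ y.col = 0 ∧ 2 ^ l < x.row ∧ x.row < y.row ∧ x.row + y.row = 3 * 2 ^ l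

/-- The grid together with all right arcs and the left arcs of level at least `l`. -/
def host (k m l : ℕ) : SimpleGraph (Vert k m) :=
  SimpleGraph.fromRel fun x y => Hor x y ∨ Ver x y ∨ RArc x y ∨ ∃ l', l ≤ l' ∧ LArc l' x y

/-! ### Crossing parity, a substitute for planarity. -/

section Parity
variable {k m l : ℕ}

/-- The edge `xy` meets the vertical ray that starts just to the right of `v` and goes towards
larger rows. -/
def Crosses (v x y : Vert k m) : Prop :=
  (v.col + 1 < m ∧ x.row = y.row ∧ v.row < x.row ∧
    (x.col = v.col ∧ y.col = v.col + 1 ∨ y.col = v.col ∧ x.col = v.col + 1)) ∨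
  (v.col + 1 = m ∧ x.col = v.col ∧ y.col = v.col ∧ x.row + y.row = 2 ^ k ∧
    (x.row ≤ v.row ∧ v.row < y.row ∨ y.row ≤ v.row ∧ v.row < x.row))

theorem Crosses.symm {v x y : Vert k m} (h : Crosses v x y) : Crosses v y x := by
  unfold Crosses at *
  omega

theorem crosses_comm {v x y : Vert k m} : Crosses v x y ↔ Crosses v y x :=
  ⟨Crosses.symm, Crosses.symm⟩

theorem block_unique {l l' r : ℕ} (h1 : 2 ^ l < r) (h2 : r < 2 ^ (l + 1)) (h3 : 2 ^ l' < r)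
    (h4 : r < 2 ^ (l' + 1)) : l = l' := by
  have a : l < l' + 1 := (Nat.pow_lt_pow_iff_right (by norm_num)).1 (h1.trans h4)
  have b : l' < l + 1 := (Nat.pow_lt_pow_iff_right (by norm_num)).1 (h3.trans h2)
  omega

theorem host_induction {p : Vert k m → Vert k m → Prop} (hs : ∀ x y, p x y → p y x)
    (hh : ∀ x y, Hor x y → p x y) (hv : ∀ x y, Ver x y → p x y)
    (hr : ∀ x y, RArc x y → p x y) (hl : ∀ l' x y, l ≤ l' → LArc l' x y → p x y)
    {x y : Vert k m} (h : (host k m l).Adj x y) : p x y := by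
  rcases h with ⟨-, (h | h | h | ⟨l', h', h⟩) | (h | h | h | ⟨l', h', h⟩)⟩
  · exact hh _ _ h
  · exact hv _ _ h
  · exact hr _ _ h
  · exact hl _ _ _ h' h
  · exact hs _ _ (hh _ _ h)
  · exact hs _ _ (hv _ _ h)
  · exact hs _ _ (hr _ _ h)
  · exact hs _ _ (hl _ _ _ h' h)

theorem crosses_of_hor {v x y : Vert k m} (h : Hor x y) :
    Crosses v x y ↔ x.col = v.col ∧ v.row < x.row := by
  have hy := y.2.2.2
  have hv := v.2.2.2
  unfold Crosses Hor at *
  generalize v.row = a at *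
  generalize x.row = b at *
  generalize y.row = c at *
  simp only [Vert.col] at *
  omega

theorem not_crosses_of_ver {v x y : Vert k m} (h : Ver x y) : ¬ Crosses v x y := by
  -- A vertical edge has odd row sum, so it cannot pass for a right arc. For `k = 0` there are no
  -- vertices.
  have hk : 2 ^ k % 2 = 0 := by
    rcases k with _ | k
    · have := x.2
      simp only [pow_zero] at this
      omega
    · omega
  unfold Crosses Ver at *
  simp only [Vert.col, Vert.row] at *
  omega

theorem crosses_of_rArc {v x y : Vert k m} (h : RArc x y) :
    Crosses v x y ↔ v.col + 1 = m ∧ x.row ≤ v.row ∧ v.row < y.row := by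
  unfold Crosses RArc at *
  simp only [Vert.col, Vert.row] at *
  omega

theorem not_crosses_of_lArc (hm : 1 < m) {v x y : Vert k m} (h : LArc l x y) :
    ¬ Crosses v x y := by
  unfold Crosses LArc at *
  simp only [Vert.col, Vert.row] at *
  omega

/-- Left arcs do not cross: those of one level are concentric, and different levels occupy disjoint
intervals of rows. -/
theorem lArc_mem_iff {l l' : ℕ} {v v' x y : Vert k m} (hv : LArc l v v') (hx : LArc l' x y) :
    v.row < x.row ∧ x.row < v'.row ↔ v.row < y.row ∧ y.row < v'.row := by
  by_cases e : l = l'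
  · subst e
    simp only [LArc, Vert.col, Vert.row] at *
    omega
  · have : ∀ r, ¬ (2 ^ l < r ∧ r < 2 ^ (l + 1) ∧ 2 ^ l' < r ∧ r < 2 ^ (l' + 1)) :=
      fun r p => e (block_unique p.1 p.2.1 p.2.2.1 p.2.2.2)
    have t1 := this x.row
    have t2 := this y.row
    rw [pow_succ, pow_succ] at t1 t2
    clear this e
    simp only [LArc, Vert.col, Vert.row] at *
    constructor <;> intro <;> omega

/-- Along an edge `vv'` of the host graph the set of crossed edges changes by a coboundary. -/
theorem exists_coboundary (hm : 1 < m) {v v' : Vert k m} (h : (host k m l).Adj v v') :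
    ∃ S : Vert k m → Prop, (∀ x, S x → x.col = 0 → 2 ^ l < x.row) ∧
      ∀ x y, (host k m l).Adj x y → x ≠ v → x ≠ v' → y ≠ v → y ≠ v' →
        ((Crosses v x y ↔ Crosses v' x y) ↔ (S x ↔ S y)) := by
  revert v v'
  refine @host_induction k m l _ ?_ ?_ ?_ ?_ ?_
  · rintro v v' ⟨S, h1, h2⟩
    refine ⟨S, h1, fun x y hxy a b c d => ?_⟩
    rw [← h2 x y hxy b a d c]
    exact iff_comm
  · rintro v v' ⟨h1, h2⟩
    -- As `v` moves right, its ray sweeps over the part of the next column in larger rows.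
    refine ⟨fun x => x.col = v'.col ∧ v.row < x.row, fun x hx _ => by omega, ?_⟩
    refine @host_induction k m l _ ?_ ?_ ?_ ?_ ?_
    · intro x y h a b c d
      rw [crosses_comm, @crosses_comm _ _ v', h c d a b]
      exact iff_comm
    · intro x y h a b c d
      rw [crosses_of_hor h, crosses_of_hor h]
      simp only [Hor, Vert.col, Vert.row] at *
      omega
    · intro x y h a b c d
      simp only [not_crosses_of_ver h, true_iff]
      rw [Ne, Vert.ext_iff'] at b d
      simp only [Ver, Vert.col, Vert.row] at *
      omega
    · intro x y h a b c d
      rw [crosses_of_rArc h, crosses_of_rArc h]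
      have := v'.2.2.2
      rw [Ne, Vert.ext_iff'] at b d
      simp only [RArc, Vert.col, Vert.row] at *
      omega
    · intro l₂ x y _ h a b c d
      simp only [not_crosses_of_lArc hm h, true_iff]
      simp only [LArc, Vert.col, Vert.row] at *
      omega
  · rintro v v' ⟨h1, h2⟩
    -- A move down by one row changes the crossed set only by edges at `v'`, which are excluded.
    refine ⟨fun x => False, fun x hx _ => hx.elim, ?_⟩
    simp only [iff_true]
    refine @host_induction k m l _ ?_ ?_ ?_ ?_ ?_
    · intro x y h a b c d
      rw [crosses_comm, @crosses_comm _ _ v', h c d a b]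
    · intro x y h a b c d
      rw [crosses_of_hor h, crosses_of_hor h]
      rw [Ne, Vert.ext_iff'] at b
      simp only [Hor, Vert.col, Vert.row] at *
      omega
    · intro x y h a b c d
      simp only [not_crosses_of_ver h]
    · intro x y h a b c d
      rw [crosses_of_rArc h, crosses_of_rArc h]
      rw [Ne, Vert.ext_iff'] at a b c d
      simp only [RArc, Vert.col, Vert.row] at *
      omega
    · intro l₂ x y _ h a b c d
      simp only [not_crosses_of_lArc hm h]
  · rintro v v' ⟨h1, h2, h3, h4⟩
    -- Right arcs are concentric, so another one passes over both ends of `vv'` or over neither.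
    refine ⟨fun x => False, fun x hx _ => hx.elim, ?_⟩
    simp only [iff_true]
    refine @host_induction k m l _ ?_ ?_ ?_ ?_ ?_
    · intro x y h a b c d
      rw [crosses_comm, @crosses_comm _ _ v', h c d a b]
    · intro x y h a b c d
      rw [crosses_of_hor h, crosses_of_hor h]
      have := y.2.2.2
      simp only [Hor, Vert.col, Vert.row] at *
      omega
    · intro x y h a b c d
      simp only [not_crosses_of_ver h]
    · intro x y h a b c d
      rw [crosses_of_rArc h, crosses_of_rArc h]
      rw [Ne, Vert.ext_iff'] at a b c d
      simp only [RArc, Vert.col, Vert.row] at *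
      omega
    · intro l₂ x y _ h a b c d
      simp only [not_crosses_of_lArc hm h]
  · rintro l' v v' hl hv
    have hv' := hv
    obtain ⟨h1, h2, h3, h4, h5⟩ := hv
    -- The left vertices enclosed by the arc.
    refine ⟨fun x => x.col = 0 ∧ v.row < x.row ∧ x.row < v'.row, fun x hx _ => ?_, ?_⟩
    · exact (Nat.pow_le_pow_right (by norm_num) hl).trans_lt (h3.trans hx.2.1)
    refine @host_induction k m l _ ?_ ?_ ?_ ?_ ?_
    · intro x y h a b c d
      rw [crosses_comm, @crosses_comm _ _ v', h c d a b]
      exact iff_comm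
    · intro x y h a b c d
      rw [crosses_of_hor h, crosses_of_hor h]
      rw [Ne, Vert.ext_iff'] at b
      simp only [Hor, Vert.col, Vert.row] at *
      omega
    · intro x y h a b c d
      simp only [not_crosses_of_ver h, true_iff]
      rw [Ne, Vert.ext_iff'] at a b c d
      simp only [Ver, Vert.col, Vert.row] at *
      omega
    · intro x y h a b c d
      rw [crosses_of_rArc h, crosses_of_rArc h]
      simp only [RArc, Vert.col, Vert.row] at *
      omega
    · intro l₂ x y _ h a b c d
      simp only [not_crosses_of_lArc hm h, true_iff, h.1, h.2.1, true_and]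
      exact lArc_mem_iff hv' h

/-- The parity of the number of edges of a walk that cross the ray at `v`. -/
noncomputable def crossParity {H : SimpleGraph (Vert k m)} (v : Vert k m) {a b : Vert k m}
    (p : H.Walk a b) : ZMod 2 := by
  classical exact (p.darts.map fun d => if Crosses v d.fst d.snd then 1 else 0).sum

-- The sum telescopes modulo 2, so a coboundary sees only the ends of a walk.
open Classical in
theorem sum_coboundary {V : Type*} {H : SimpleGraph V} (S : V → Prop) {a b : V}
    (p : H.Walk a b) :
    (p.darts.map fun d => if S d.fst ↔ S d.snd then (0 : ZMod 2) else 1).sum =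
      (if S a then 1 else 0) + (if S b then 1 else 0) := by
  induction p with
  | nil =>
    simp only [SimpleGraph.Walk.darts_nil, List.map_nil, List.sum_nil]
    split_ifs <;> decide
  | @cons u v w h p ih =>
    simp only [SimpleGraph.Walk.darts_cons, List.map_cons, List.sum_cons, ih]
    by_cases h1 : S u <;> by_cases h2 : S v <;> by_cases h3 : S w <;> simp [h1, h2, h3] <;> decide

open Classical in
theorem crossParity_eq {H : SimpleGraph (Vert k m)} {v v' : Vert k m} {a b : Vert k m}
    (p : H.Walk a b) (S : Vert k m → Prop)
    (h : ∀ x y, H.Adj x y → x ∈ p.support → y ∈ p.support →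
      ((Crosses v x y ↔ Crosses v' x y) ↔ (S x ↔ S y))) :
    crossParity v p = crossParity v' p + ((if S a then 1 else 0) + (if S b then 1 else 0)) := by
  rw [← sum_coboundary S p]
  unfold crossParity
  rw [← List.sum_map_add]
  congr 1
  refine List.map_congr_left fun d hd => ?_
  have := h _ _ d.adj (p.dart_fst_mem_support_of_mem_darts hd)
    (p.dart_snd_mem_support_of_mem_darts hd)
  by_cases e : S d.fst ↔ S d.snd
  · simp only [this.2 e, if_pos e, add_zero]
  · have e' := mt this.1 e
    rw [if_neg e]
    by_cases h2 : Crosses v' d.fst d.snd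
    · rw [if_pos h2, if_neg fun h1 => e' (iff_of_true h1 h2)]
      decide
    · rw [if_neg h2, if_pos (by_contra fun h1 => e' (iff_of_false h1 h2)), zero_add]

theorem crossParity_eq_zero {H : SimpleGraph (Vert k m)} {v : Vert k m} {a b : Vert k m}
    (p : H.Walk a b) (h : ∀ x y, H.Adj x y → ¬ Crosses v x y) : crossParity v p = 0 := by
  unfold crossParity
  refine List.sum_eq_zero fun z hz => ?_
  obtain ⟨d, -, rfl⟩ := List.mem_map.1 hz
  rw [if_neg (h _ _ d.adj)]

/-- The parity of the crossings with a walk does not change along a second, disjoint walk. -/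
theorem crossParity_const (hm : 1 < m) {H : SimpleGraph (Vert k m)} (hH : H ≤ host k m l)
    {a b u w : Vert k m} (p : H.Walk a b) (q : H.Walk u w)
    (ha : a.col = 0) (ha' : a.row ≤ 2 ^ l) (hb : b.col = 0) (hb' : b.row ≤ 2 ^ l)
    (hd : ∀ x ∈ p.support, x ∉ q.support) : crossParity u p = crossParity w p := by
  induction q with
  | nil => rfl
  | @cons u v w h q ih =>
    rw [← ih fun x hx hx' => hd x hx (by simp [hx'])]
    obtain ⟨S, h1, h2⟩ := exists_coboundary hm (hH h)
    have hu : ∀ x ∈ p.support, x ≠ u := by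
      rintro x hx rfl
      exact hd x hx (by simp)
    have hv : ∀ x ∈ p.support, x ≠ v := by
      rintro x hx rfl
      exact hd x hx (by simp)
    rw [crossParity_eq p S fun x y hxy hx hy =>
      h2 x y (hH hxy) (hu x hx) (hv x hx) (hu y hy) (hv y hy),
      if_neg fun h => (h1 _ h ha).not_ge ha', if_neg fun h => (h1 _ h hb).not_ge hb']
    simp

-- Away from `v`, the crossed edges form the coboundary of the part of the left column in rows
-- larger than that of `v`. Left arcs do not disturb this: those of level at least `l` have both
-- ends in rows beyond `2 ^ l`.
open Classical in
theorem crossParity_left (hm : 1 < m) {H : SimpleGraph (Vert k m)} (hH : H ≤ host k m l)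
    {a b v : Vert k m} (p : H.Walk a b) (hv : v.col = 0) (hv' : v.row ≤ 2 ^ l)
    (ha : a.col = 0) (hb : b.col = 0) (hd : v ∉ p.support) :
    crossParity v p =
      (if v.row < a.row then 1 else 0) + (if v.row < b.row then 1 else 0) := by
  have key : ∀ {x y}, (host k m l).Adj x y → x ≠ v → y ≠ v →
      (¬ Crosses v x y ↔ ((x.col = 0 ∧ v.row < x.row) ↔ (y.col = 0 ∧ v.row < y.row))) := by
    refine @host_induction k m l _ ?_ ?_ ?_ ?_ ?_
    · intro x y h a b
      rw [crosses_comm, h b a]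
      exact iff_comm
    · intro x y h a b
      rw [crosses_of_hor h]
      simp only [Hor, Vert.col, Vert.row] at *
      omega
    · intro x y h a b
      simp only [not_crosses_of_ver h, not_false_eq_true, true_iff]
      rw [Ne, Vert.ext_iff'] at a b
      simp only [Ver, Vert.col, Vert.row] at *
      omega
    · intro x y h a b
      rw [crosses_of_rArc h]
      simp only [RArc, Vert.col, Vert.row] at *
      omega
    · intro l₂ x y hl h a b
      simp only [not_crosses_of_lArc hm h, not_false_eq_true, true_iff]
      have := Nat.pow_le_pow_right (n := 2) (by norm_num) hl
      simp only [LArc, Vert.col, Vert.row] at *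
      omega
  have := sum_coboundary (fun x => x.col = 0 ∧ v.row < x.row) p
  simp only [ha, hb, true_and] at this
  rw [← this]
  unfold crossParity
  congr 1
  refine List.map_congr_left fun d hd' => ?_
  have h1 : d.fst ≠ v := by
    rintro rfl
    exact hd (p.dart_fst_mem_support_of_mem_darts hd')
  have h2 : d.snd ≠ v := by
    rintro rfl
    exact hd (p.dart_snd_mem_support_of_mem_darts hd')
  have := key (hH d.adj) h1 h2
  by_cases h3 : Crosses v d.fst d.snd
  · rw [if_pos h3, if_neg (by tauto)]
  · rw [if_neg h3, if_pos (by tauto)]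

/-- Two disjoint walks cannot interlace, where the second one may end at any vertex whose ray is
not crossed by an edge of the graph. -/
theorem reachable_of_interlace_ray (hm : 1 < m) {H : SimpleGraph (Vert k m)}
    (hH : H ≤ host k m l) {a b c w : Vert k m} (ha : a.col = 0) (hb : b.col = 0) (hc : c.col = 0)
    (hab : a.row < b.row) (hbc : b.row < c.row) (hcl : c.row ≤ 2 ^ l)
    (h1 : H.Reachable a c) (h2 : H.Reachable b w) (hw : ∀ x y, H.Adj x y → ¬ Crosses w x y) :
    H.Reachable a b := by
  obtain ⟨p⟩ := h1
  obtain ⟨q⟩ := h2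
  by_contra hn
  have hd : ∀ x ∈ p.support, x ∉ q.support := by
    intro x hx hx'
    classical
    exact hn ((p.takeUntil x hx).reachable.trans (q.takeUntil x hx').reachable.symm)
  -- The parity of `p` is 1 at `b`, which lies between the ends of `p`, but 0 at `w`.
  have e1 := crossParity_const hm hH p q ha (by omega) hc hcl hd
  rw [crossParity_eq_zero p hw, crossParity_left hm hH p hb (by omega) ha hc
    fun h => hd _ h q.start_mem_support, if_neg (by omega), if_pos hbc] at e1
  revert e1
  decide

/-- Two disjoint walks with ends in the left column cannot interlace. -/
theorem reachable_of_interlace (hm : 1 < m) {H : SimpleGraph (Vert k m)}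
    (hH : H ≤ host k m l) {a b c d : Vert k m} (ha : a.col = 0) (hb : b.col = 0) (hc : c.col = 0)
    (hd' : d.col = 0) (hab : a.row < b.row) (hbc : b.row < c.row) (hcd : c.row < d.row)
    (hdl : d.row ≤ 2 ^ l) (h1 : H.Reachable a c) (h2 : H.Reachable b d) :
    H.Reachable a b := by
  obtain ⟨p⟩ := h1
  obtain ⟨q⟩ := h2
  by_contra hn
  have hd : ∀ x ∈ p.support, x ∉ q.support := by
    intro x hx hx'
    classical
    exact hn ((p.takeUntil x hx).reachable.trans (q.takeUntil x hx').reachable.symm)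
  -- Exactly one end of `p` lies beyond `b` and none lies beyond `d`, so the parities are 1 and 0.
  have e1 := crossParity_const hm hH p q ha (by omega) hc (by omega) hd
  rw [crossParity_left hm hH p hb (by omega) ha hc fun h => hd _ h q.start_mem_support,
    crossParity_left hm hH p hd' (by omega) ha hc fun h => hd _ h q.end_mem_support,
    if_neg (by omega), if_pos hbc, if_neg (by omega), if_neg (by omega)] at e1
  revert e1
  decide

end Parity

/-! ### Uniqueness: the left arcs, level by level. -/

/-- Stop a walk just before its first step outside `H'`. -/
theorem reachable_or_exists {V : Type*} {H H' : SimpleGraph V} {P : V → V → Prop}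
    (h : ∀ x y, H.Adj x y → H'.Adj x y ∨ P x y) {u v : V} (huv : H.Reachable u v) :
    H'.Reachable u v ∨ ∃ x y, P x y ∧ H'.Reachable u x := by
  obtain ⟨p⟩ := huv
  induction p with
  | nil => exact Or.inl (SimpleGraph.Reachable.refl _)
  | @cons u w v e p ih =>
    rcases h _ _ e with h1 | h1
    · rcases ih with h2 | ⟨x, y, h2, h3⟩
      · exact Or.inl (h1.reachable.trans h2)
      · exact Or.inr ⟨x, y, h2, h1.reachable.trans h3⟩
    · exact Or.inr ⟨u, w, h1, SimpleGraph.Reachable.refl _⟩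

/-- There are as many values available as arguments, so strict monotonicity leaves no slack;
induction from either end gives the two inequalities. -/
theorem eq_of_strictAnti {N : ℕ} {f : ℕ → ℕ} (h1 : ∀ r, 0 < r → r < N → N < f r ∧ f r < 2 * N)
    (h2 : ∀ r s, 0 < r → r < s → s < N → f s < f r) {r : ℕ} (h : 0 < r) (h' : r < N) :
    r + f r = 2 * N := by
  have up : ∀ r, 0 < r → r < N → f r + r ≤ 2 * N := by
    intro r hr
    induction r, hr using Nat.le_induction with
    | base =>
      intro h
      have := h1 1 one_pos h
      change f 1 + 1 ≤ 2 * N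
      omega
    | succ r hr ih =>
      intro h
      have := ih (by omega)
      have := h2 r (r + 1) hr (by omega) h
      omega
  have down : ∀ d, 0 < d → d < N → N + d ≤ f (N - d) := by
    intro d hd
    induction d, hd using Nat.le_induction with
    | base =>
      intro h
      have := h1 (N - 1) (by omega) (by omega)
      change N + 1 ≤ f (N - 1)
      omega
    | succ d hd ih =>
      intro h
      have := ih (by omega)
      have := h2 (N - (d + 1)) (N - d) (by omega) (by omega) (by omega)
      omega
  have a := up r h h'
  have b := down (N - r) (by omega) (by omega)
  rw [show N - (N - r) = r by omega] at b
  omega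

/-- The first terminal of the path with index `j`. -/
def IsSource {k m : ℕ} (j : ℕ) (v : Vert k m) : Prop := v.row = 2 ^ j ∧ v.col = 0

/-- The second terminal of the path with index `j`. -/
def IsTarget {k m : ℕ} (j : ℕ) (v : Vert k m) : Prop :=
  j + 1 < k ∧ v.row = 3 * 2 ^ j ∧ v.col = 0 ∨ j + 1 = k ∧ v.row = 2 ^ j ∧ v.col + 1 = m

/-- The linkage that consists of all rows and all arcs. -/
def standard (k m : ℕ) : SimpleGraph (Vert k m) :=
  SimpleGraph.fromRel fun x y => Hor x y ∨ RArc x y ∨ ∃ l, LArc l x y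

section Unique
variable {k m : ℕ}

/-- Left vertices that represent the components at stage `p`. -/
def Rep (p : ℕ) (v : Vert k m) : Prop :=
  v.col = 0 ∧ (v.row ≤ 2 ^ p ∨ ∃ j, p ≤ j ∧ v.row = 2 ^ j)

/-- The state of a linkage after the left arcs of level at most `p` have been removed. -/
structure Stage (Q : SimpleGraph (Vert k m)) (p : ℕ) : Prop where
  nest : ∀ a b : Vert k m, a.col = 0 → b.col = 0 → a.row + b.row = 2 ^ (p + 1) →
    (Q ⊓ host k m (p + 1)).Reachable a b
  link : ∀ j, p ≤ j → ∀ s t : Vert k m, IsSource j s → IsTarget j t →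
    (Q ⊓ host k m (p + 1)).Reachable s t
  disj : ∀ a b : Vert k m, Rep p a → Rep p b → (Q ⊓ host k m (p + 1)).Reachable a b → a = b
  arcs : ∀ l, l ≤ p → ∀ x y : Vert k m, LArc l x y → Q.Adj x y

theorem host_adj_of_adj {l : ℕ} {x y : Vert k m} (h : (host k m l).Adj x y) :
    (host k m (l + 1)).Adj x y ∨ LArc l x y ∨ LArc l y x := by
  have key : ∀ {x y : Vert k m}, (Hor x y ∨ Ver x y ∨ RArc x y ∨ ∃ l', l ≤ l' ∧ LArc l' x y) →
      (Hor x y ∨ Ver x y ∨ RArc x y ∨ ∃ l', l + 1 ≤ l' ∧ LArc l' x y) ∨ LArc l x y := by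
    rintro x y (h | h | h | ⟨l', h1, h⟩)
    · simp [h]
    · simp [h]
    · simp [h]
    · rcases h1.eq_or_lt with rfl | h2
      · exact Or.inr h
      · exact Or.inl (Or.inr (Or.inr (Or.inr ⟨l', h2, h⟩)))
  obtain ⟨h0, h | h⟩ := h
  · rcases key h with h | h
    · exact Or.inl ⟨h0, Or.inl h⟩
    · exact Or.inr (Or.inl h)
  · rcases key h with h | h
    · exact Or.inl ⟨h0, Or.inr h⟩
    · exact Or.inr (Or.inr h)

theorem host_mono {l l' : ℕ} (h : l ≤ l') : host k m l' ≤ host k m l := by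
  rintro x y ⟨h0, h1⟩
  refine ⟨h0, h1.imp ?_ ?_⟩ <;>
  · rintro (h1 | h1 | h1 | ⟨l₂, h2, h1⟩)
    · exact Or.inl h1
    · exact Or.inr (Or.inl h1)
    · exact Or.inr (Or.inr (Or.inl h1))
    · exact Or.inr (Or.inr (Or.inr ⟨l₂, h.trans h2, h1⟩))

/-- The block `1 < r < 2` is empty, so nothing is removed, and the representatives at stage 0 are
sources. -/
theorem stage_zero {Q : SimpleGraph (Vert k m)} (hQ : Q ≤ host k m 0)
    (hST : ∀ j, ∀ s t : Vert k m, IsSource j s → IsTarget j t → Q.Reachable s t)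
    (hSS : ∀ i j, ∀ s t : Vert k m, IsSource i s → IsSource j t → Q.Reachable s t → s = t) :
    Stage Q 0 := by
  have harc : ∀ x y : Vert k m, ¬ LArc 0 x y := by
    intro x y h
    simp only [LArc, Vert.row, Vert.col] at h
    omega
  have e : Q ⊓ host k m 1 = Q := by
    refine inf_eq_left.2 fun x y h => ?_
    rcases host_adj_of_adj (hQ h) with h | h | h
    · exact h
    · exact (harc _ _ h).elim
    · exact (harc _ _ h).elim
  have hrep : ∀ a : Vert k m, Rep 0 a → ∃ j, IsSource j a := by
    rintro a ⟨h1, h2 | ⟨j, -, h2⟩⟩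
    · have := a.2.1
      exact ⟨0, by simp only [pow_zero, Vert.row] at *; omega, h1⟩
    · exact ⟨j, h2, h1⟩
  constructor
  · intro a b h1 h2 h3
    have : a = b := by
      have := a.2.1
      have := b.2.1
      rw [Vert.ext_iff']
      simp only [Vert.row, Vert.col] at *
      omega
    rw [this]
  · intro j _ s t hs ht
    rw [zero_add, e]
    exact hST j s t hs ht
  · intro a b ha hb h
    rw [zero_add, e] at h
    obtain ⟨i, hi⟩ := hrep a ha
    obtain ⟨j, hj⟩ := hrep b hb
    exact hSS i j a b hi hj h
  · intro l hl x y h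
    rw [Nat.le_zero.1 hl] at h
    exact (harc _ _ h).elim

/-- Every left vertex in the first rows is connected to a representative. -/
theorem Stage.exists_rep {Q : SimpleGraph (Vert k m)} {p : ℕ} (hS : Stage Q p) (a : Vert k m)
    (h : a.col = 0) (h' : a.row < 2 ^ (p + 1)) :
    ∃ a' : Vert k m, a'.col = 0 ∧ a'.row ≤ 2 ^ p ∧ (a' = a ∨ a'.row + a.row = 2 ^ (p + 1)) ∧
      (Q ⊓ host k m (p + 1)).Reachable a a' := by
  rcases le_or_gt a.row (2 ^ p) with h1 | h1
  · exact ⟨a, h, h1, Or.inl rfl, SimpleGraph.Reachable.refl _⟩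
  · have := a.2
    rw [pow_succ] at h'
    simp only [Vert.row, Vert.col] at *
    refine ⟨⟨(2 ^ (p + 1) - a.row, 0), ?_⟩, rfl, ?_, Or.inr ?_, hS.nest _ _ h rfl ?_⟩ <;>
      simp only [pow_succ, Vert.row] <;> omega

/-- Distinct left vertices in the first rows lie in distinct components of a subgraph, if those
paired by the nest do. -/
theorem Stage.separated {Q H' : SimpleGraph (Vert k m)} {p : ℕ} (hS : Stage Q p)
    (hH' : H' ≤ Q ⊓ host k m (p + 1))
    (hn : ∀ a b : Vert k m, a.col = 0 → b.col = 0 → a.row < 2 ^ p →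
      a.row + b.row = 2 ^ (p + 1) → ¬ H'.Reachable a b)
    {a b : Vert k m} (ha : a.col = 0) (ha' : a.row < 2 ^ (p + 1))
    (hb : b.col = 0) (hb' : b.row < 2 ^ (p + 1)) (h : H'.Reachable a b) : a = b := by
  obtain ⟨a', h1, h2, h3, h4⟩ := hS.exists_rep a ha ha'
  obtain ⟨b', h1', h2', h3', h4'⟩ := hS.exists_rep b hb hb'
  -- Both vertices fold to the same representative, so if distinct they are mirror images, and `hn`
  -- applies.
  have e : a' = b' := hS.disj _ _ ⟨h1, Or.inl h2⟩ ⟨h1', Or.inl h2'⟩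
    (h4.symm.trans ((h.mono hH').trans h4'))
  subst e
  by_contra hne
  have key : a.row + b.row = 2 ^ (p + 1) ∧ a.row ≠ b.row := by
    rw [Vert.ext_iff'] at hne h3 h3'
    simp only [Vert.row, Vert.col] at *
    omega
  rcases lt_or_gt_of_ne key.2 with h5 | h5
  · exact hn a b ha hb (by have := key.1; rw [pow_succ] at this; omega) key.1 h
  · exact hn b a hb ha (by have := key.1; rw [pow_succ] at this; omega) (by omega) h.symm

/-- The vertex of a given row in the left column. -/
theorem exists_left (hm : 1 < m) {r : ℕ} (h : 0 < r) (h' : r < 2 ^ k) :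
    ∃ a : Vert k m, a.row = r ∧ a.col = 0 :=
  ⟨⟨(r, 0), h, h', by dsimp only; omega⟩, rfl, rfl⟩

/-- The vertex in row `2 ^ p` must reach block `p + 1`, because its target lies in the middle of
that block. Without the arcs of level `p + 1`, a connection between two mirror images around row `2
^ p` would interlace with this walk. Hence the connection provided by `nest` uses such an arc, and
from either side the first one met gives `x`. -/
theorem Stage.exists_arc (hm : 1 < m) {Q : SimpleGraph (Vert k m)} {p : ℕ} (hp : p + 2 ≤ k)
    (hS : Stage Q p) :
    (∀ a : Vert k m, a.col = 0 → a.row < 2 ^ (p + 1) → ∃ x : Vert k m, x.col = 0 ∧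
      2 ^ (p + 1) < x.row ∧ x.row < 2 ^ (p + 2) ∧ (Q ⊓ host k m (p + 2)).Reachable a x ∧
      (a.row ≠ 2 ^ p → ∃ y, Q.Adj x y ∧ (LArc (p + 1) x y ∨ LArc (p + 1) y x))) ∧
    ∀ a b : Vert k m, a.col = 0 → b.col = 0 → a.row < 2 ^ p →
      a.row + b.row = 2 ^ (p + 1) → ¬ (Q ⊓ host k m (p + 2)).Reachable a b := by
  set H := Q ⊓ host k m (p + 1) with hH
  set H' := Q ⊓ host k m (p + 2) with hH'
  have hle : H' ≤ H := inf_le_inf le_rfl (host_mono (Nat.le_succ _))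
  have hpk : 2 ^ (p + 2) ≤ 2 ^ k := Nat.pow_le_pow_right (by norm_num) hp
  have hor : ∀ {u v : Vert k m}, H.Reachable u v → H'.Reachable u v ∨
      ∃ x y, (Q.Adj x y ∧ (LArc (p + 1) x y ∨ LArc (p + 1) y x)) ∧ H'.Reachable u x := by
    refine fun huv => reachable_or_exists (fun x y h => ?_) huv
    rcases host_adj_of_adj h.2 with h1 | h1
    · exact Or.inl ⟨h.1, h1⟩
    · exact Or.inr ⟨h.1, h1⟩
  have hblock : ∀ {x y : Vert k m}, (LArc (p + 1) x y ∨ LArc (p + 1) y x) →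
      x.col = 0 ∧ 2 ^ (p + 1) < x.row ∧ x.row < 2 ^ (p + 2) := by
    intro x y h
    rw [pow_succ 2 (p + 1)]
    simp only [LArc, Vert.row, Vert.col] at *
    omega
  have hmid : ∀ a : Vert k m, a.col = 0 → a.row = 2 ^ p → ∃ x : Vert k m, x.col = 0 ∧
      2 ^ (p + 1) < x.row ∧ x.row < 2 ^ (p + 2) ∧ H'.Reachable a x := by
    intro a h1 h2
    have hpos : 0 < 2 ^ p := Nat.two_pow_pos p
    rw [pow_succ, pow_succ] at hpk
    obtain ⟨t, ht1, ht2⟩ := @exists_left k m hm (3 * 2 ^ p) (by omega) (by omega)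
    rcases hor (hS.link p le_rfl a t ⟨h2, h1⟩ (Or.inl ⟨hp, ht1, ht2⟩)) with h3 | ⟨x, y, h3, h4⟩
    · exact ⟨t, ht2, by rw [pow_succ]; omega, by rw [pow_succ, pow_succ]; omega, h3⟩
    · obtain ⟨h5, h6, h7⟩ := hblock h3.2
      exact ⟨x, h5, h6, h7, h4⟩
  have hn : ∀ a b : Vert k m, a.col = 0 → b.col = 0 → a.row < 2 ^ p →
      a.row + b.row = 2 ^ (p + 1) → ¬ H'.Reachable a b := by
    intro a b ha hb hap hab hr
    have hpos : 0 < 2 ^ p := Nat.two_pow_pos p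
    obtain ⟨c, hc1, hc2⟩ := @exists_left k m hm (2 ^ p) hpos
      (Nat.pow_lt_pow_right (by norm_num) (by omega))
    obtain ⟨x, h1, h2, h3, h4⟩ := hmid c hc2 hc1
    have hb0 := a.2.1
    have h5 := reachable_of_interlace hm (inf_le_right : H' ≤ _) ha hc2 hb h1 (by omega)
      (by rw [pow_succ] at hab; omega) (by simp only [Vert.row] at *; omega) h3.le hr h4
    have h6 := hS.disj a c ⟨ha, Or.inl hap.le⟩ ⟨hc2, Or.inl hc1.le⟩ (h5.mono hle)
    rw [h6] at hap
    omega
  refine ⟨fun a ha ha' => ?_, hn⟩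
  rcases eq_or_ne a.row (2 ^ p) with h | h
  · obtain ⟨x, h1, h2, h3, h4⟩ := hmid a ha h
    exact ⟨x, h1, h2, h3, h4, fun h' => (h' h).elim⟩
  · have h0 := a.2.1
    obtain ⟨b, hb1, hb2⟩ := @exists_left k m hm (2 ^ (p + 1) - a.row) (by omega)
      (by rw [pow_succ] at hpk; omega)
    rcases hor (hS.nest a b ha hb2 (by omega)) with h3 | ⟨x, y, h3, h4⟩
    · rcases lt_or_gt_of_ne h with h4 | h4
      · exact (hn a b ha hb2 h4 (by omega) h3).elim
      · exact (hn b a hb2 ha (by rw [hb1, pow_succ]; omega) (by omega) h3.symm).elim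
    · obtain ⟨h5, h6, h7⟩ := hblock h3.2
      exact ⟨x, h5, h6, h7, h4, fun _ => ⟨y, h3⟩⟩

/-- The arrivals in the block are distinct and, by noncrossing, in reversed order. The block has
exactly `2 ^ (p + 1) - 1` rows, one for each start, so the matching is the reflection. -/
theorem Stage.reachable_arc (hm : 1 < m) {Q : SimpleGraph (Vert k m)} {p : ℕ} (hp : p + 2 ≤ k)
    (hS : Stage Q p) {a x : Vert k m} (ha : a.col = 0) (hx : x.col = 0)
    (ha' : a.row < 2 ^ (p + 1)) (hax : a.row + x.row = 2 ^ (p + 2)) :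
    (Q ⊓ host k m (p + 2)).Reachable a x ∧
      (a.row ≠ 2 ^ p → ∃ y, Q.Adj x y ∧ (LArc (p + 1) x y ∨ LArc (p + 1) y x)) := by
  obtain ⟨hF, hn⟩ := hS.exists_arc hm hp
  have hle : Q ⊓ host k m (p + 2) ≤ Q ⊓ host k m (p + 1) :=
    inf_le_inf le_rfl (host_mono (Nat.le_succ _))
  have hpk : 2 ^ (p + 2) ≤ 2 ^ k := Nat.pow_le_pow_right (by norm_num) hp
  have hpk' : 2 ^ (p + 1) ≤ 2 ^ (p + 2) := Nat.pow_le_pow_right (by norm_num) (by omega)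
  -- The bounds are hypotheses inside the existential, so that `choose` gives functions on all of
  -- `ℕ`.
  have hex : ∀ r, ∃ a x : Vert k m, 0 < r → r < 2 ^ (p + 1) → a.row = r ∧ a.col = 0 ∧
      x.col = 0 ∧ 2 ^ (p + 1) < x.row ∧ x.row < 2 ^ (p + 2) ∧
      (Q ⊓ host k m (p + 2)).Reachable a x ∧
      (a.row ≠ 2 ^ p → ∃ y, Q.Adj x y ∧ (LArc (p + 1) x y ∨ LArc (p + 1) y x)) := by
    intro r
    by_cases h : 0 < r ∧ r < 2 ^ (p + 1)
    · obtain ⟨a, h1, h2⟩ := @exists_left k m hm r h.1 (by omega)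
      obtain ⟨x, h3⟩ := hF a h2 (by omega)
      exact ⟨a, x, fun _ _ => ⟨h1, h2, h3⟩⟩
    · exact ⟨a, a, fun h1 h2 => (h ⟨h1, h2⟩).elim⟩
  choose A X hAX using hex
  have key : ∀ r, 0 < r → r < 2 ^ (p + 1) → r + (X r).row = 2 * 2 ^ (p + 1) := by
    intro r hr hr'
    refine @eq_of_strictAnti _ (fun r => (X r).row) (fun r hr hr' => ?_)
      (fun r s hr hrs hs => ?_) r hr hr'
    · obtain ⟨-, -, -, h1, h2, -⟩ := hAX r hr hr'
      rw [pow_succ 2 (p + 1)] at h2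
      exact ⟨h1, by simp only [Vert.row] at *; omega⟩
    · obtain ⟨h1, h2, h3, h4, h5, h6, -⟩ := hAX r hr (by omega)
      obtain ⟨h1', h2', h3', h4', h5', h6', -⟩ := hAX s (by omega) hs
      have hsep : ¬ (Q ⊓ host k m (p + 2)).Reachable (A r) (A s) := by
        intro h
        have := hS.separated hle hn h2 (by omega) h2' (by omega) h
        rw [this] at h1
        omega
      by_contra hlt
      rcases (not_lt.1 hlt).eq_or_lt with h7 | h7
      · have : X r = X s := Vert.ext_iff'.2 ⟨h7, h3.trans h3'.symm⟩
        rw [this] at h6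
        exact hsep (h6.trans h6'.symm)
      · exact hsep (reachable_of_interlace hm (inf_le_right : Q ⊓ host k m (p + 2) ≤ _)
          h2 h2' h3 h3' (by omega) (by omega) h7 h5'.le h6 h6')
  have ha0 := a.2.1
  obtain ⟨h1, h2, h3, -, -, h6, h7⟩ := hAX a.row ha0 ha'
  have h8 := key a.row ha0 ha'
  have e1 : A a.row = a := Vert.ext_iff'.2 ⟨h1, h2.trans ha.symm⟩
  have e2 : X a.row = x := by
    refine Vert.ext_iff'.2 ⟨?_, h3.trans hx.symm⟩
    rw [pow_succ 2 (p + 1)] at hax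
    omega
  rw [e1] at h6 h7
  rw [e2] at h6 h7
  exact ⟨h6, h7⟩

/-- Every vertex of block `p + 1` is now joined to a left vertex in a row below `2 ^ (p + 1)`. Paths
of later sources avoid those components by `disj`, hence use no arc of this level, and their links
survive its removal. -/
theorem Stage.succ (hm : 1 < m) {Q : SimpleGraph (Vert k m)} {p : ℕ} (hp : p + 2 ≤ k)
    (hS : Stage Q p) : Stage Q (p + 1) := by
  obtain ⟨hF, hn⟩ := hS.exists_arc hm hp
  have hle : Q ⊓ host k m (p + 2) ≤ Q ⊓ host k m (p + 1) :=
    inf_le_inf le_rfl (host_mono (Nat.le_succ _))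
  have hpk : 2 ^ (p + 2) ≤ 2 ^ k := Nat.pow_le_pow_right (by norm_num) hp
  have hpow : 2 ^ (p + 2) = 2 ^ (p + 1) * 2 := pow_succ _ _
  have hpow' : 2 ^ (p + 1) = 2 ^ p * 2 := pow_succ _ _
  have hpos : 0 < 2 ^ p := Nat.two_pow_pos p
  have hsrc : ∀ (a s : Vert k m) (j : ℕ), a.col = 0 → a.row < 2 ^ (p + 1) → p + 1 ≤ j →
      IsSource j s → ¬ (Q ⊓ host k m (p + 1)).Reachable s a := by
    intro a s j ha ha' hj hs h
    obtain ⟨a', h1, h2, -, h4⟩ := hS.exists_rep a ha ha'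
    have h5 := hS.disj s a' ⟨hs.2, Or.inr ⟨j, by omega, hs.1⟩⟩ ⟨h1, Or.inl h2⟩ (h.trans h4)
    have := Nat.pow_le_pow_right (n := 2) (by norm_num) hj
    rw [← h5, hs.1] at h2
    omega
  have hrep : ∀ a : Vert k m, Rep (p + 1) a →
      a.row < 2 ^ (p + 1) ∨ ∃ j, p + 1 ≤ j ∧ IsSource j a := by
    rintro a ⟨h1, h2 | ⟨j, hj, h2⟩⟩
    · rcases h2.eq_or_lt with h3 | h3
      · exact Or.inr ⟨p + 1, le_rfl, h3, h1⟩
      · exact Or.inl h3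
    · exact Or.inr ⟨j, hj, h2, h1⟩
  constructor
  · intro a b ha hb hab
    rcases lt_trichotomy a.row (2 ^ (p + 1)) with h | h | h
    · exact (hS.reachable_arc hm hp ha hb h hab).1
    · have : a = b := Vert.ext_iff'.2 ⟨by omega, ha.trans hb.symm⟩
      rw [this]
    · exact (hS.reachable_arc hm hp hb ha (by omega) (by omega)).1.symm
  · intro j hj s t hs ht
    refine (reachable_or_exists (P := fun x y => LArc (p + 1) x y ∨ LArc (p + 1) y x)
      (fun x y h => ?_) (hS.link j (by omega) s t hs ht)).resolve_right ?_
    · rcases host_adj_of_adj h.2 with h1 | h1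
      · exact Or.inl ⟨h.1, h1⟩
      · exact Or.inr h1
    · rintro ⟨x, y, h1, h2⟩
      have hx : x.col = 0 ∧ 2 ^ (p + 1) < x.row ∧ x.row < 2 ^ (p + 2) := by
        simp only [LArc, Vert.row, Vert.col] at *
        omega
      obtain ⟨a, ha1, ha2⟩ := @exists_left k m hm (2 ^ (p + 2) - x.row) (by omega) (by omega)
      have h3 := (hS.reachable_arc hm hp ha2 hx.1 (by omega) (by omega)).1
      exact hsrc a s j ha2 (by omega) hj hs ((h2.trans h3.symm).mono hle)
  · intro a b ha hb h
    rcases hrep a ha with h1 | ⟨i, hi, h1⟩ <;> rcases hrep b hb with h2 | ⟨j, hj, h2⟩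
    · exact hS.separated hle hn ha.1 h1 hb.1 h2 h
    · exact (hsrc a b j ha.1 h1 hj h2 (h.mono hle).symm).elim
    · exact (hsrc b a i hb.1 h2 hi h1 (h.mono hle)).elim
    · exact hS.disj a b ⟨h1.2, Or.inr ⟨i, by omega, h1.1⟩⟩ ⟨h2.2, Or.inr ⟨j, by omega, h2.1⟩⟩
        (h.mono hle)
  · intro l hl x y h
    rcases hl.eq_or_lt with rfl | hl
    -- An end of an arc is not in the middle row `3 * 2 ^ p`, so its mirror image is not in row `2 ^
    -- p` and an arc of `Q` at `x` is forced.
    · have hx : x.row < 2 ^ (p + 2) ∧ 2 ^ (p + 1) < x.row ∧ 2 ^ (p + 2) - x.row ≠ 2 ^ p := by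
        simp only [LArc, Vert.row, Vert.col] at *
        omega
      obtain ⟨a, ha1, ha2⟩ := @exists_left k m hm (2 ^ (p + 2) - x.row) (by omega) (by omega)
      obtain ⟨y', h1, h2⟩ :=
        (hS.reachable_arc hm hp ha2 h.1 (by omega) (by omega)).2 (by rw [ha1]; exact hx.2.2)
      have : y' = y := by
        rw [Vert.ext_iff']
        simp only [LArc, Vert.row, Vert.col] at *
        omega
      rwa [← this]
    · exact hS.arcs l (by omega) x y h

/-! ### Uniqueness: the rows and the right arcs. -/

/-- The edges between column `c` and the next one. In the last column these are the right arcs. -/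
def CutEdge (c : ℕ) (x y : Vert k m) : Prop :=
  (x.row = y.row ∧ (x.col = c ∧ y.col = c + 1 ∨ y.col = c ∧ x.col = c + 1)) ∨
  (c + 1 = m ∧ x.col = c ∧ y.col = c ∧ x.row + y.row = 2 ^ k ∧ x.row ≠ y.row)

/-- The graph without the edges between column `c` and the next one. -/
def cut (H : SimpleGraph (Vert k m)) (c : ℕ) : SimpleGraph (Vert k m) where
  Adj x y := H.Adj x y ∧ ¬ CutEdge c x y
  symm := ⟨fun x y h => ⟨h.1.symm, fun h' => h.2 (by unfold CutEdge at *; omega)⟩⟩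
  loopless := ⟨fun x h => h.1.ne rfl⟩

theorem col_le_iff_of_not_cutEdge {c l : ℕ} (hc : c + 1 < m) {u v : Vert k m}
    (h : (host k m l).Adj u v) : ¬ CutEdge c u v → (u.col ≤ c ↔ v.col ≤ c) := by
  revert u v
  refine @host_induction k m l _ ?_ ?_ ?_ ?_ ?_
  · intro u v h h'
    refine (h fun h1 => h' ?_).symm
    unfold CutEdge at *
    omega
  all_goals
    intros
    simp only [CutEdge, Hor, Ver, RArc, LArc, Vert.row, Vert.col] at *
    omega

/-- The target of the middle row `2 ^ p` is now at the right end, so its path reaches column `c`.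
After the cut no edge crosses the ray there, so this path separates the mirror pairs, and every left
vertex must reach column `c` at a cut edge or at the last target. The arrivals lie in different
components and number `2 ^ k - 1`, so they fill the column. -/
theorem Stage.exists_cut (hm : 1 < m) {Q : SimpleGraph (Vert k m)} {p : ℕ} (hp : p + 1 = k)
    (hS : Stage Q p) {c : ℕ} (hc : c < m) (x : Vert k m) (hx : x.col = c) :
    (c + 1 = m ∧ x.row = 2 ^ p) ∨ ∃ y, Q.Adj x y ∧ (Hor x y ∨ RArc x y ∨ RArc y x) := by
  set H := Q ⊓ host k m (p + 1) with hH
  have hle : cut H c ≤ H := fun x y h => h.1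
  have hpos : 0 < 2 ^ p := Nat.two_pow_pos p
  have hpow : 2 ^ (p + 1) = 2 ^ p * 2 := pow_succ _ _
  have hpk : 2 ^ k = 2 ^ (p + 1) := by rw [hp]
  have hray : ∀ w : Vert k m, w.col = c → ∀ x y, (cut H c).Adj x y → ¬ Crosses w x y := by
    intro w hw x y h h'
    refine h.2 ?_
    unfold Crosses at h'
    unfold CutEdge
    simp only [Vert.row, Vert.col] at *
    omega
  have hside : c + 1 < m → ∀ {a x : Vert k m}, (cut H c).Reachable a x → a.col ≤ c →
      x.col ≤ c := by
    rintro hc1 a x ⟨q⟩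
    induction q with
    | nil => exact id
    | @cons u v w h q ih => exact fun hu => ih ((col_le_iff_of_not_cutEdge hc1 h.1.2 h.2).1 hu)
  have hor : ∀ {u v : Vert k m}, u.col = 0 → H.Reachable u v → (cut H c).Reachable u v ∨
      ∃ x, x.col = c ∧ (cut H c).Reachable u x ∧
        ∃ y, Q.Adj x y ∧ (Hor x y ∨ RArc x y ∨ RArc y x) := by
    intro u v hu huv
    refine (reachable_or_exists (P := fun x y => Q.Adj x y ∧ CutEdge c x y)
      (fun x y h => ?_) huv).imp_right ?_
    · by_cases h1 : CutEdge c x y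
      · exact Or.inr ⟨h.1, h1⟩
      · exact Or.inl ⟨h, h1⟩
    · rintro ⟨x, y, ⟨h1, h2⟩, h3⟩
      have hy := y.2.2.2
      have hx := x.2.2.2
      have h4 : x.col = c := by
        by_cases hc1 : c + 1 < m
        · have := hside hc1 h3 (by omega)
          simp only [CutEdge, Vert.row, Vert.col] at *
          omega
        · simp only [CutEdge, Vert.row, Vert.col] at *
          omega
      refine ⟨x, h4, h3, y, h1, ?_⟩
      clear h1 h3 hside hray
      simp only [CutEdge, Hor, RArc, Vert.row, Vert.col] at *
      omega
  have hmid : ∀ a : Vert k m, a.col = 0 → a.row = 2 ^ p → ∃ x : Vert k m, x.col = c ∧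
      (cut H c).Reachable a x ∧ ((c + 1 = m ∧ x.row = 2 ^ p) ∨
        ∃ y, Q.Adj x y ∧ (Hor x y ∨ RArc x y ∨ RArc y x)) := by
    intro a h1 h2
    let t : Vert k m := ⟨(2 ^ p, m - 1), hpos, by dsimp only; omega, Nat.sub_lt (by omega) one_pos⟩
    have ht : t.col + 1 = m := Nat.sub_add_cancel hm.le
    rcases hor h1 (hS.link p le_rfl a t ⟨h2, h1⟩ (Or.inr ⟨hp, rfl, ht⟩)) with h3 | ⟨x, h3, h4, h5⟩
    · have hc1 : c + 1 = m := by
        by_contra hc1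
        have := hside (by omega) h3 (by omega)
        omega
      exact ⟨t, Nat.succ_injective (ht.trans hc1.symm), h3, Or.inl ⟨hc1, rfl⟩⟩
    · exact ⟨x, h3, h4, Or.inr h5⟩
  have hn : ∀ a b : Vert k m, a.col = 0 → b.col = 0 → a.row < 2 ^ p →
      a.row + b.row = 2 ^ (p + 1) → ¬ (cut H c).Reachable a b := by
    intro a b ha hb hap hab hr
    obtain ⟨d, hd1, hd2⟩ := @exists_left k m hm (2 ^ p) hpos (by omega)
    obtain ⟨x, h1, h2, -⟩ := hmid d hd2 hd1
    have h5 := reachable_of_interlace_ray hm (hle.trans inf_le_right) ha hd2 hb (by omega)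
      (by omega) (b.2.2.1.trans_eq hpk).le hr h2 (hray x h1)
    have h6 := hS.disj a d ⟨ha, Or.inl hap.le⟩ ⟨hd2, Or.inl hd1.le⟩ (h5.mono hle)
    rw [h6] at hap
    omega
  have hF : ∀ a : Vert k m, a.col = 0 → ∃ x : Vert k m, x.col = c ∧
      (cut H c).Reachable a x ∧ ((c + 1 = m ∧ x.row = 2 ^ p) ∨
        ∃ y, Q.Adj x y ∧ (Hor x y ∨ RArc x y ∨ RArc y x)) := by
    intro a ha
    have h0 : 0 < a.row := a.2.1
    have h0' : a.row < 2 ^ k := a.2.2.1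
    rcases eq_or_ne a.row (2 ^ p) with h | h
    · exact hmid a ha h
    · obtain ⟨b, hb1, hb2⟩ := @exists_left k m hm (2 ^ (p + 1) - a.row) (by omega) (by omega)
      rcases hor ha (hS.nest a b ha hb2 (by omega)) with h3 | ⟨x, h3, h4, h5⟩
      · rcases lt_or_gt_of_ne h with h4 | h4
        · exact (hn a b ha hb2 h4 (by omega) h3).elim
        · exact (hn b a hb2 ha (by omega) (by omega) h3.symm).elim
      · exact ⟨x, h3, h4, Or.inr h5⟩
  have hm0 : 0 < m := by omega
  choose F hF1 hF2 hF3 using fun a : {r // 0 < r ∧ r < 2 ^ k} =>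
    hF ⟨(a.1, 0), a.2.1, a.2.2, hm0⟩ rfl
  have hfin : Finite {r // 0 < r ∧ r < 2 ^ k} :=
    ((Set.finite_Iio (2 ^ k)).subset fun r hr => hr.2 : {r | 0 < r ∧ r < 2 ^ k}.Finite)
  have hinj : Function.Injective fun a => (⟨(F a).row, (F a).2.1, (F a).2.2.1⟩ :
      {r // 0 < r ∧ r < 2 ^ k}) := by
    intro a b hab
    have e : F a = F b := Vert.ext_iff'.2 ⟨Subtype.ext_iff.1 hab, (hF1 a).trans (hF1 b).symm⟩
    have h1 := hF2 a
    rw [e] at h1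
    have h2 := hS.separated hle hn rfl (a.2.2.trans_eq hpk) rfl (b.2.2.trans_eq hpk)
      (h1.trans (hF2 b).symm)
    exact Subtype.ext (Vert.ext_iff'.1 h2).1
  obtain ⟨a, ha⟩ := Finite.surjective_of_injective hinj ⟨x.row, x.2.1, x.2.2.1⟩
  have e : F a = x := Vert.ext_iff'.2 ⟨Subtype.ext_iff.1 ha, (hF1 a).trans hx.symm⟩
  rw [← e]
  exact hF3 a

/-- A linkage in the host graph with the standard pattern uses all rows and all arcs. -/
theorem standard_le (hm : 1 < m) (hk : 1 ≤ k) {Q : SimpleGraph (Vert k m)} (hQ : Q ≤ host k m 0)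
    (hST : ∀ j, ∀ s t : Vert k m, IsSource j s → IsTarget j t → Q.Reachable s t)
    (hSS : ∀ i j, ∀ s t : Vert k m, IsSource i s → IsSource j t → Q.Reachable s t → s = t) :
    standard k m ≤ Q := by
  have hst : ∀ p, p + 1 ≤ k → Stage Q p := by
    intro p
    induction p with
    | zero => exact fun _ => stage_zero hQ hST hSS
    | succ p ih => exact fun hp => (ih (by omega)).succ hm hp
  obtain ⟨p, rfl⟩ := Nat.exists_eq_add_of_le' hk
  have hS := hst p le_rfl
  have key : ∀ {x y : Vert (p + 1) m}, (Hor x y ∨ RArc x y ∨ ∃ l, LArc l x y) → Q.Adj x y := by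
    rintro x y (h | h | ⟨l, h⟩)
    · have hy := y.2.2.2
      obtain ⟨h1, h2⟩ := h
      rcases hS.exists_cut hm rfl x.2.2.2 x rfl with h3 | ⟨z, h3, h4⟩
      · simp only [Vert.col] at *
        omega
      · have : z = y := by
          rw [Vert.ext_iff']
          simp only [Hor, RArc, Vert.row, Vert.col] at *
          omega
        rwa [← this]
    · rcases hS.exists_cut hm rfl x.2.2.2 x rfl with h3 | ⟨z, h3, h4⟩
      · rw [RArc, pow_succ] at h
        omega
      · have hz := z.2.2.2
        have : z = y := by
          rw [Vert.ext_iff']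
          simp only [Hor, RArc, Vert.row, Vert.col] at *
          omega
        rwa [← this]
    · have h1 : 2 ^ l < 2 ^ (p + 1) := h.2.2.1.trans x.2.2.1
      have h2 : l < p + 1 := (Nat.pow_lt_pow_iff_right (by norm_num)).1 h1
      exact hS.arcs l (by omega) x y h
  rintro x y ⟨-, h | h⟩
  · exact key h
  · exact (key h).symm

end Unique

/-! ### Recognising paths by degrees. -/

section PathGraph
variable {V : Type*} {G : SimpleGraph V}

theorem exists_adj_dist (hc : G.Connected) {s v : V} {d : ℕ} (h : G.dist s v = d + 1) :
    ∃ x, G.Adj x v ∧ G.dist s x = d := by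
  obtain ⟨p, hp⟩ := hc.exists_walk_length_eq_dist v s
  rw [G.dist_comm, h] at hp
  cases p with
  | nil => simp at hp
  | @cons _ x _ e q =>
    refine ⟨x, e.symm, ?_⟩
    have h1 := SimpleGraph.dist_le q.reverse
    have h2 := hc.dist_triangle (u := s) (v := x) (w := v)
    rw [SimpleGraph.dist_eq_one_iff_adj.2 e.symm] at h2
    simp only [SimpleGraph.Walk.length_cons, SimpleGraph.Walk.length_reverse] at hp h1
    omega

/-- A finite connected graph of maximum degree at most two with a vertex of degree at most one
is a path. -/
theorem isPathGraph_of_degree_le_two [Finite V] (hc : G.Connected) (s : V)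
    (h1 : ∀ a b, G.Adj s a → G.Adj s b → a = b)
    (h2 : ∀ v a b c, G.Adj v a → G.Adj v b → G.Adj v c → a = b ∨ a = c ∨ b = c) :
    IsPathGraph G := by
  -- Two vertices at equal distance share a predecessor by induction. It is `s`, or has a third
  -- neighbour closer to `s`; both contradict the degree bounds unless they coincide.
  have inj : ∀ d u v, G.dist s u = d → G.dist s v = d → u = v := by
    intro d
    induction d with
    | zero =>
      intro u v hu hv
      rw [← hc.dist_eq_zero_iff.1 hu, ← hc.dist_eq_zero_iff.1 hv]
    | succ d ih =>
      intro u v hu hv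
      obtain ⟨x, hx, hxd⟩ := exists_adj_dist hc hu
      obtain ⟨y, hy, hyd⟩ := exists_adj_dist hc hv
      obtain rfl := ih x y hxd hyd
      rcases d with _ | d
      · obtain rfl := hc.dist_eq_zero_iff.1 hxd
        exact h1 u v hx hy
      · obtain ⟨z, hz, hzd⟩ := exists_adj_dist hc hxd
        rcases h2 x u v z hx hy hz.symm with h | h | h
        · exact h
        · rw [h] at hu
          omega
        · rw [h] at hv
          omega
  have : Nonempty V := ⟨s⟩
  obtain ⟨w, hw⟩ := Finite.exists_max (G.dist s)
  have surj : ∀ e d, d + e = G.dist s w → ∃ v, G.dist s v = d := by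
    intro e
    induction e with
    | zero => exact fun d h => ⟨w, h.symm⟩
    | succ e ih =>
      intro d h
      obtain ⟨v, hv⟩ := ih (d + 1) (by omega)
      obtain ⟨x, -, hx⟩ := exists_adj_dist hc hv
      exact ⟨x, hx⟩
  let f : V → Fin (G.dist s w + 1) := fun v => ⟨G.dist s v, Nat.lt_succ_of_le (hw v)⟩
  have hf : Function.Bijective f := by
    refine ⟨fun u v h => inj _ u v rfl (Fin.ext_iff.1 h).symm, fun i => ?_⟩
    obtain ⟨v, hv⟩ := surj (G.dist s w - i) i (by have := i.2; omega)
    exact ⟨v, Fin.ext hv⟩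
  refine ⟨_, Nat.succ_pos _, ⟨⟨Equiv.ofBijective f hf, ?_⟩⟩⟩
  intro u v
  rw [Equiv.ofBijective_apply, Equiv.ofBijective_apply, SimpleGraph.pathGraph_adj]
  constructor
  · have key : ∀ u v, G.dist s u + 1 = G.dist s v → G.Adj u v := by
      intro u v h
      obtain ⟨x, hx, hxd⟩ := exists_adj_dist hc h.symm
      rwa [inj _ u x rfl hxd]
    rintro (h | h)
    · exact key u v h
    · exact (key v u h).symm
  · intro h
    have h3 := hc.dist_triangle (u := s) (v := u) (w := v)
    have h4 := hc.dist_triangle (u := s) (v := v) (w := u)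
    rw [SimpleGraph.dist_eq_one_iff_adj.2 h] at h3
    rw [SimpleGraph.dist_eq_one_iff_adj.2 h.symm] at h4
    have h5 : G.dist s u ≠ G.dist s v := fun h5 => h.ne (inj _ u v rfl h5.symm)
    change G.dist s u + 1 = G.dist s v ∨ G.dist s v + 1 = G.dist s u
    omega

/-- In a linkage every vertex has degree at most two. -/
theorem IsSpanningLinkage.degree_le_two {L : SimpleGraph V} (h : IsSpanningLinkage G L)
    {v a b c : V} (ha : L.Adj v a) (hb : L.Adj v b) (hc : L.Adj v c) :
    a = b ∨ a = c ∨ b = c := by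
  obtain ⟨n, -, ⟨e⟩⟩ := h.2 (L.connectedComponentMk v)
  have hmem : ∀ {x}, L.Adj v x → x ∈ L.connectedComponentMk v := fun hx =>
    SimpleGraph.ConnectedComponent.sound hx.reachable.symm
  let v' : L.connectedComponentMk v := ⟨v, rfl⟩
  have hadj : ∀ {x} (hx : L.Adj v x), (e v').val + 1 = (e ⟨x, hmem hx⟩).val ∨
      (e ⟨x, hmem hx⟩).val + 1 = (e v').val := by
    intro x hx
    rw [← SimpleGraph.pathGraph_adj, e.map_adj_iff]
    exact hx
  have hinj : ∀ {x y} (hx : L.Adj v x) (hy : L.Adj v y),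
      (e ⟨x, hmem hx⟩).val = (e ⟨y, hmem hy⟩).val → x = y := fun hx hy hxy =>
    Subtype.ext_iff.1 (e.injective (Fin.ext hxy))
  have ha' := hadj ha
  have hb' := hadj hb
  have hc' := hadj hc
  have h1 := hinj ha hb
  have h2 := hinj ha hc
  have h3 := hinj hb hc
  by_contra hne
  push Not at hne
  have := mt h1 hne.1
  have := mt h2 hne.2.1
  have := mt h3 hne.2.2
  omega

end PathGraph

/-! ### The standard linkage: structure and vitality. -/

section Standard
variable {k m : ℕ}

/-- The next vertex to the right in the standard linkage. -/
def RightOf (v x : Vert k m) : Prop :=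
  x.row = v.row ∧ x.col = v.col + 1 ∨
  v.col + 1 = m ∧ x.col + 1 = m ∧ x.row + v.row = 2 ^ k ∧ x.row ≠ v.row

/-- The next vertex to the left in the standard linkage. -/
def LeftOf (v x : Vert k m) : Prop :=
  x.row = v.row ∧ x.col + 1 = v.col ∨
  v.col = 0 ∧ x.col = 0 ∧ ∃ l, 2 ^ l < v.row ∧ v.row < 2 ^ (l + 1) ∧
    x.row + v.row = 3 * 2 ^ l ∧ x.row ≠ v.row

theorem standard_adj_iff {v x : Vert k m} :
    (standard k m).Adj v x ↔ RightOf v x ∨ LeftOf v x := by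
  constructor
  · rintro ⟨-, (h | h | ⟨l, h⟩) | (h | h | ⟨l, h⟩)⟩
    · exact Or.inl (Or.inl ⟨h.1.symm, h.2.symm⟩)
    · left; right
      simp only [RArc, Vert.row, Vert.col] at *
      omega
    · right; right
      refine ⟨h.1, h.2.1, l, ?_⟩
      rw [pow_succ]
      simp only [LArc, Vert.row, Vert.col] at *
      omega
    · exact Or.inr (Or.inl h)
    · left; right
      simp only [RArc, Vert.row, Vert.col] at *
      omega
    · right; right
      refine ⟨h.2.1, h.1, l, ?_⟩
      rw [pow_succ]
      simp only [LArc, Vert.row, Vert.col] at *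
      omega
  · have hne : RightOf v x ∨ LeftOf v x → v ≠ x := by
      rintro ((h | h) | (h | ⟨-, -, l, h⟩)) rfl <;> omega
    intro h
    refine ⟨hne h, ?_⟩
    rcases h with (h | h) | (h | ⟨h1, h2, l, h3⟩)
    · exact Or.inl (Or.inl ⟨h.1.symm, h.2.symm⟩)
    · rcases lt_or_gt_of_ne h.2.2.2 with h4 | h4
      · exact Or.inr (Or.inr (Or.inl ⟨h.2.1, h.1, h4, h.2.2.1⟩))
      · exact Or.inl (Or.inr (Or.inl ⟨h.1, h.2.1, h4, by omega⟩))
    · exact Or.inr (Or.inl h)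
    · rw [pow_succ] at h3
      rcases lt_or_gt_of_ne h3.2.2.2 with h4 | h4
      · exact Or.inr (Or.inr (Or.inr ⟨l, h2, h1, by omega, h4, h3.2.2.1⟩))
      · exact Or.inl (Or.inr (Or.inr ⟨l, h1, h2, h3.1, h4, by omega⟩))

theorem RightOf.unique {v x y : Vert k m} (hx : RightOf v x) (hy : RightOf v y) : x = y := by
  have h1 := x.2.2.2
  have h2 := y.2.2.2
  rw [Vert.ext_iff']
  simp only [RightOf, Vert.row, Vert.col] at *
  omega

theorem LeftOf.unique {v x y : Vert k m} (hx : LeftOf v x) (hy : LeftOf v y) : x = y := by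
  rw [Vert.ext_iff']
  rcases hx with hx | ⟨h1, h2, l, h3, h4, h5, -⟩ <;>
    rcases hy with hy | ⟨h1', h2', l', h3', h4', h5', -⟩
  · simp only [Vert.row, Vert.col] at *
    omega
  · omega
  · omega
  · obtain rfl := block_unique h3 h4 h3' h4'
    simp only [Vert.row, Vert.col] at *
    omega

theorem RightOf.ne (hm : 1 < m) {v x y : Vert k m} (hx : RightOf v x) (hy : LeftOf v y) :
    x ≠ y := by
  rintro rfl
  have hb : v.col = 0 ∧ x.col = 0 ∨ x.row = v.row ∧ x.col + 1 = v.col :=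
    hy.symm.imp_left fun h => ⟨h.1, h.2.1⟩
  simp only [RightOf, Vert.row, Vert.col] at *
  omega

theorem exists_rightOf {v : Vert k m} (h : v.col + 1 = m → 2 * v.row ≠ 2 ^ k) :
    ∃ x, RightOf v x := by
  have h1 : v.row < 2 ^ k := v.2.2.1
  have h2 : 0 < v.row := v.2.1
  by_cases h3 : v.col + 1 = m
  · have := h h3
    exact ⟨⟨(2 ^ k - v.row, v.col), by dsimp only; omega, by dsimp only; omega, v.2.2.2⟩,
      Or.inr ⟨h3, h3, by change 2 ^ k - v.row + v.row = _; omega,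
        by change 2 ^ k - v.row ≠ _; omega⟩⟩
  · have := v.2.2.2
    exact ⟨⟨(v.row, v.col + 1), h2, h1, by dsimp only [Vert.col] at *; omega⟩, Or.inl ⟨rfl, rfl⟩⟩

theorem exists_leftOf {v : Vert k m}
    (h : v.col = 0 → ∀ l, v.row ≠ 2 ^ l ∧ v.row ≠ 3 * 2 ^ l) : ∃ x, LeftOf v x := by
  have h1 : v.row < 2 ^ k := v.2.2.1
  have h2 : 0 < v.row := v.2.1
  have h0 := v.2.2.2
  by_cases h3 : v.col = 0
  · set l := Nat.log 2 v.row with hl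
    have h4 : 2 ^ l ≤ v.row := Nat.pow_log_le_self 2 h2.ne'
    have h5 : v.row < 2 ^ (l + 1) := Nat.lt_pow_succ_log_self (by norm_num) _
    have h6 := (h h3 l).1
    have h7 : l < k := (Nat.pow_lt_pow_iff_right (by norm_num)).1 (h4.trans_lt h1)
    -- The middle of block `l` is row `3 * 2 ^ (l - 1)`, a target row.
    have h8 : 2 * v.row ≠ 3 * 2 ^ l := by
      rcases l.eq_zero_or_pos with h8 | h8
      · rw [h8]
        omega
      · obtain ⟨i, hi⟩ := Nat.exists_eq_add_of_lt h8
        have := (h h3 i).2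
        rw [hi, zero_add, pow_succ]
        omega
    have h9 : 2 ^ (l + 1) ≤ 2 ^ k := Nat.pow_le_pow_right (by norm_num) h7
    have h10 := pow_succ 2 l
    exact ⟨⟨(3 * 2 ^ l - v.row, v.col), by dsimp only; omega, by dsimp only; omega, h0⟩,
      Or.inr ⟨h3, h3, l, by omega, h5, by change 3 * 2 ^ l - v.row + v.row = _; omega,
        by change 3 * 2 ^ l - v.row ≠ _; omega⟩⟩
  · exact ⟨⟨(v.row, v.col - 1), h2, h1, by dsimp only [Vert.col] at *; omega⟩,
      Or.inl ⟨rfl, by simp only [Vert.col] at *; omega⟩⟩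

theorem not_rightOf {v x : Vert k m} (h1 : v.col + 1 = m) (h2 : 2 * v.row = 2 ^ k) :
    ¬ RightOf v x := by
  have := x.2.2.2
  simp only [RightOf, Vert.row, Vert.col] at *
  omega

theorem not_leftOf {v x : Vert k m} (h : v.col = 0) {l : ℕ}
    (h' : v.row = 2 ^ l ∨ v.row = 3 * 2 ^ l) : ¬ LeftOf v x := by
  rintro (h1 | ⟨-, -, i, h1, h2, h3, h4⟩)
  · omega
  · rcases h' with h' | h'
    · rw [h'] at h1 h2
      have := (Nat.pow_lt_pow_iff_right (by norm_num)).1 h1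
      have := (Nat.pow_lt_pow_iff_right (by norm_num)).1 h2
      omega
    · have h5 := pow_succ 2 l
      have h6 := pow_succ 2 (l + 1)
      obtain rfl := block_unique h1 h2 (l' := l + 1) (by omega) (by omega)
      omega

/-- The ends of the standard linkage are the terminals. -/
def IsTerminal (v : Vert k m) : Prop := ∃ j, IsSource j v ∨ IsTarget j v

theorem isTerminal_or {v : Vert k m} (hk : 0 < k) (h : IsTerminal v) :
    (v.col = 0 ∧ ∃ l, v.row = 2 ^ l ∨ v.row = 3 * 2 ^ l) ∨
      (v.col + 1 = m ∧ 2 * v.row = 2 ^ k) := by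
  obtain ⟨j, h | ⟨-, h1, h2⟩ | ⟨rfl, h1, h2⟩⟩ := h
  · exact Or.inl ⟨h.2, j, Or.inl h.1⟩
  · exact Or.inl ⟨h2, j, Or.inr h1⟩
  · exact Or.inr ⟨h2, by rw [h1, pow_succ]; omega⟩

theorem isTerminal_of {v : Vert k m} (hk : 0 < k)
    (h : (v.col = 0 ∧ ∃ l, v.row = 2 ^ l ∨ v.row = 3 * 2 ^ l) ∨
      (v.col + 1 = m ∧ 2 * v.row = 2 ^ k)) : IsTerminal v := by
  have h0 : v.row < 2 ^ k := v.2.2.1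
  obtain ⟨k, rfl⟩ := Nat.exists_eq_add_of_le' (show 1 ≤ k from hk)
  rcases h with ⟨h1, j, h2 | h2⟩ | ⟨h1, h2⟩
  · exact ⟨j, Or.inl ⟨h2, h1⟩⟩
  · refine ⟨j, Or.inr (Or.inl ⟨?_, h2, h1⟩)⟩
    have h3 : 2 ^ (j + 1) < 2 ^ (k + 1) := by
      have := Nat.two_pow_pos j
      rw [pow_succ 2 j]
      omega
    exact (Nat.pow_lt_pow_iff_right (by norm_num)).1 h3
  · exact ⟨k, Or.inr (Or.inr ⟨rfl, by rw [pow_succ] at h2; omega, h1⟩)⟩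

theorem IsTerminal.adj_unique (hk : 0 < k) {v a b : Vert k m} (h : IsTerminal v)
    (ha : (standard k m).Adj v a) (hb : (standard k m).Adj v b) : a = b := by
  rw [standard_adj_iff] at ha hb
  rcases isTerminal_or hk h with ⟨h1, l, h2⟩ | ⟨h1, h2⟩
  · exact (ha.resolve_right (not_leftOf h1 h2)).unique (hb.resolve_right (not_leftOf h1 h2))
  · exact (ha.resolve_left (not_rightOf h1 h2)).unique (hb.resolve_left (not_rightOf h1 h2))

theorem isEnd_standard (hm : 1 < m) (hk : 0 < k) {v : Vert k m} (h : IsTerminal v) :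
    IsEnd (standard k m) v := by
  have : ∃ x, (standard k m).Adj v x := by
    simp only [standard_adj_iff]
    rcases isTerminal_or hk h with ⟨h1, l, h2⟩ | ⟨h1, h2⟩
    · obtain ⟨x, hx⟩ := exists_rightOf (v := v) (by omega)
      exact ⟨x, Or.inl hx⟩
    · obtain ⟨x, hx⟩ := exists_leftOf (v := v) (by omega)
      exact ⟨x, Or.inr hx⟩
  obtain ⟨x, hx⟩ := this
  rw [IsEnd, Set.ncard_eq_one]
  exact ⟨x, Set.ext fun y => ⟨fun hy => h.adj_unique hk hy hx, fun hy => hy ▸ hx⟩⟩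

theorem exists_adj_ne (hm : 1 < m) (hk : 0 < k) {v : Vert k m} (h : ¬ IsTerminal v) :
    ∃ a b, a ≠ b ∧ (standard k m).Adj v a ∧ (standard k m).Adj v b := by
  have h' := mt (isTerminal_of hk) h
  push Not at h'
  obtain ⟨x, hx⟩ := exists_rightOf h'.2
  obtain ⟨y, hy⟩ := exists_leftOf h'.1
  exact ⟨x, y, hx.ne hm hy, standard_adj_iff.2 (Or.inl hx), standard_adj_iff.2 (Or.inr hy)⟩

theorem standard_degree_le_two {v a b c : Vert k m} (ha : (standard k m).Adj v a)
    (hb : (standard k m).Adj v b) (hc : (standard k m).Adj v c) : a = b ∨ a = c ∨ b = c := by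
  rw [standard_adj_iff] at ha hb hc
  rcases ha with ha | ha <;> rcases hb with hb | hb
  · exact Or.inl (ha.unique hb)
  · rcases hc with hc | hc
    · exact Or.inr (Or.inl (ha.unique hc))
    · exact Or.inr (Or.inr (hb.unique hc))
  · rcases hc with hc | hc
    · exact Or.inr (Or.inr (hb.unique hc))
    · exact Or.inr (Or.inl (ha.unique hc))
  · exact Or.inl (ha.unique hb)

theorem reachable_row {a b : Vert k m} (h : a.row = b.row) : (standard k m).Reachable a b := by
  have key : ∀ n, ∀ a b : Vert k m, a.row = b.row → a.col + n = b.col →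
      (standard k m).Reachable a b := by
    intro n
    induction n with
    | zero =>
      intro a b h1 h2
      rw [Vert.ext_iff'.2 ⟨h1, h2⟩]
    | succ n ih =>
      intro a b h1 h2
      have hb := b.2.2.2
      let c : Vert k m := ⟨(a.row, a.col + 1), a.2.1, a.2.2.1, by
        dsimp only [Vert.col] at *; omega⟩
      exact (standard_adj_iff.2 (Or.inl (Or.inl ⟨rfl, rfl⟩)) :
        (standard k m).Adj a c).reachable.trans (ih c b h1 (by change a.col + 1 + n = _; omega))
  rcases le_total a.col b.col with h' | h'
  · exact key (b.col - a.col) a b h (by omega)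
  · exact (key (a.col - b.col) b a h.symm (by omega)).symm

/-- Downward from the right arcs at `l = k`: if `a + b = 2 ^ l`, the mirror rows `2 ^ (l + 1) - a`
and `2 ^ (l + 1) - b` add up to `3 * 2 ^ l`, so a left arc joins them unless they are equal. -/
theorem reachable_of_add_eq {l : ℕ} (hl : l ≤ k) {a b : Vert k m} (h : a.row + b.row = 2 ^ l) :
    (standard k m).Reachable a b := by
  induction hl using Nat.decreasingInduction generalizing a b with
  | self =>
    have hm : 0 < m := a.2.2.2.pos
    let a' : Vert k m := ⟨(a.row, m - 1), a.2.1, a.2.2.1, Nat.sub_lt hm one_pos⟩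
    let b' : Vert k m := ⟨(b.row, m - 1), b.2.1, b.2.2.1, Nat.sub_lt hm one_pos⟩
    have h1 : (standard k m).Reachable a' b' := by
      by_cases e : b.row = a.row
      · exact reachable_row e.symm
      · exact ((standard_adj_iff (v := a') (x := b')).2 (Or.inl (Or.inr
          ⟨Nat.sub_add_cancel (show 1 ≤ m from hm), Nat.sub_add_cancel (show 1 ≤ m from hm),
          (add_comm _ _).trans h, e⟩))).reachable
    exact (reachable_row (a := a) (b := a') rfl).trans
      (h1.trans (reachable_row (a := b') (b := b) rfl))
  | of_succ l hl ih =>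
    have hm : 0 < m := a.2.2.2.pos
    have h1 := pow_succ 2 l
    have h2 : 2 ^ (l + 1) ≤ 2 ^ k := Nat.pow_le_pow_right (by norm_num) hl
    have ha : 0 < a.row := a.2.1
    have hb : 0 < b.row := b.2.1
    let c : Vert k m := ⟨(2 ^ (l + 1) - a.row, 0), by dsimp only; omega, by dsimp only; omega, hm⟩
    let d : Vert k m := ⟨(2 ^ (l + 1) - b.row, 0), by dsimp only; omega, by dsimp only; omega, hm⟩
    have hc : c.row = 2 ^ (l + 1) - a.row := rfl
    have hd : d.row = 2 ^ (l + 1) - b.row := rfl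
    have hcd : (standard k m).Reachable c d := by
      by_cases e : d.row = c.row
      · exact reachable_row e.symm
      · exact (standard_adj_iff.2 (Or.inr (Or.inr ⟨rfl, rfl, l, by omega, by omega, by omega,
          e⟩))).reachable
    exact (ih (by omega)).trans (hcd.trans (ih (by omega)))

/-- A row strictly between `2 ^ l` and `2 ^ (l + 1)` is joined to the smaller row `2 ^ (l + 1) - r`;
the descent stops at a power of two. -/
theorem exists_source_reachable (v : Vert k m) :
    ∃ j s, j < k ∧ IsSource j s ∧ (standard k m).Reachable s v := by
  obtain ⟨r, hr⟩ : ∃ r, v.row = r := ⟨_, rfl⟩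
  induction r using Nat.strong_induction_on generalizing v with
  | _ r ih =>
    have hm : 0 < m := v.2.2.2.pos
    have h1 : v.row < 2 ^ k := v.2.2.1
    have h2 : 0 < v.row := v.2.1
    set l := Nat.log 2 v.row with hl
    have h4 : 2 ^ l ≤ v.row := Nat.pow_log_le_self 2 h2.ne'
    have h5 : v.row < 2 ^ (l + 1) := Nat.lt_pow_succ_log_self (by norm_num) _
    have h7 : l < k := (Nat.pow_lt_pow_iff_right (by norm_num)).1 (h4.trans_lt h1)
    have h10 := pow_succ 2 l
    rcases h4.eq_or_lt with h6 | h6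
    · exact ⟨l, ⟨(v.row, 0), v.2.1, v.2.2.1, hm⟩, h7, ⟨h6.symm, rfl⟩, reachable_row rfl⟩
    · let w : Vert k m := ⟨(2 ^ (l + 1) - v.row, 0), by dsimp only; omega, by dsimp only; omega, hm⟩
      have hw : w.row = 2 ^ (l + 1) - v.row := rfl
      obtain ⟨j, s, h8, h9, h11⟩ := ih w.row (by omega) w rfl
      exact ⟨j, s, h8, h9, h11.trans (reachable_of_add_eq (l := l + 1) h7 (by omega))⟩

theorem reachable_source_target (j : ℕ) {s t : Vert k m} (hs : IsSource j s)
    (ht : IsTarget j t) : (standard k m).Reachable s t := by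
  rcases ht with ⟨h1, h2, -⟩ | ⟨-, h2, -⟩
  · refine reachable_of_add_eq (l := j + 2) h1 ?_
    rw [hs.1, h2, pow_succ, pow_succ]
    omega
  · exact reachable_row (hs.1.trans h2.symm)

/-- A row below `2 ^ k` divisible by `2 ^ n` has `n < k`, and one in block `l` has `n ≤ l`, so both
reflections preserve the divisibility. This tells the sources apart. -/
theorem dvd_row_of_reachable {n : ℕ} {a b : Vert k m} (h : (standard k m).Reachable a b)
    (ha : 2 ^ n ∣ a.row) : 2 ^ n ∣ b.row := by
  obtain ⟨p⟩ := h
  induction p with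
  | nil => exact ha
  | @cons u v w h p ih =>
    refine ih ?_
    rw [standard_adj_iff] at h
    rcases h with (h | h) | (h | ⟨h1, h2, l, h3, h4, h5, h6⟩)
    · rwa [h.1]
    · have hn : 2 ^ n ∣ 2 ^ k := by
        refine Nat.pow_dvd_pow 2 (le_of_lt ?_)
        exact (Nat.pow_lt_pow_iff_right (by norm_num)).1
          ((Nat.le_of_dvd u.2.1 ha).trans_lt u.2.2.1)
      rw [← h.2.2.1] at hn
      exact (Nat.dvd_add_left ha).1 hn
    · rwa [h.1]
    · have hn : 2 ^ n ∣ 3 * 2 ^ l := by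
        refine Dvd.dvd.mul_left (Nat.pow_dvd_pow 2 (Nat.lt_succ_iff.1 ?_)) 3
        exact (Nat.pow_lt_pow_iff_right (by norm_num)).1 ((Nat.le_of_dvd u.2.1 ha).trans_lt h4)
      rw [← h5] at hn
      exact (Nat.dvd_add_left ha).1 hn

theorem source_unique {i j : ℕ} {s t : Vert k m} (hs : IsSource i s) (ht : IsSource j t)
    (h : (standard k m).Reachable s t) : i = j := by
  have h1 : 2 ^ i ∣ t.row := dvd_row_of_reachable h (dvd_of_eq hs.1.symm)
  have h2 : 2 ^ j ∣ s.row := dvd_row_of_reachable h.symm (dvd_of_eq ht.1.symm)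
  rw [ht.1] at h1
  rw [hs.1] at h2
  exact le_antisymm ((Nat.pow_dvd_pow_iff_le_right (by norm_num)).1 h1)
    ((Nat.pow_dvd_pow_iff_le_right (by norm_num)).1 h2)

theorem card_components (hm : 1 < m) : Nat.card (standard k m).ConnectedComponent = k := by
  have hm0 : 0 < m := by omega
  let src : Fin k → Vert k m := fun j =>
    ⟨(2 ^ j.1, 0), Nat.two_pow_pos _, Nat.pow_lt_pow_right (by norm_num) j.2, hm0⟩
  have hsrc : ∀ j : Fin k, IsSource j.1 (src j) := fun j => ⟨rfl, rfl⟩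
  have hb : Function.Bijective fun j => (standard k m).connectedComponentMk (src j) := by
    constructor
    · intro i j h
      exact Fin.ext (source_unique (hsrc i) (hsrc j) (SimpleGraph.ConnectedComponent.exact h))
    · intro C
      induction C using SimpleGraph.ConnectedComponent.ind with
      | h v =>
        obtain ⟨j, s, h1, h2, h3⟩ := exists_source_reachable v
        refine ⟨⟨j, h1⟩, SimpleGraph.ConnectedComponent.sound ?_⟩
        have : src ⟨j, h1⟩ = s := Vert.ext_iff'.2 ⟨h2.1.symm, h2.2.symm⟩
        rwa [this]
  rw [← Nat.card_eq_of_bijective _ hb, Nat.card_fin]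

instance : Finite (Vert k m) :=
  ((Set.finite_Iio (2 ^ k)).prod (Set.finite_Iio m)).subset fun _ hp => ⟨hp.2.1, hp.2.2⟩

theorem standard_le_host : standard k m ≤ host k m 0 := by
  rintro x y ⟨h0, h⟩
  refine ⟨h0, h.imp ?_ ?_⟩ <;>
  · rintro (h | h | ⟨l, h⟩)
    · exact Or.inl h
    · exact Or.inr (Or.inr (Or.inl h))
    · exact Or.inr (Or.inr (Or.inr ⟨l, Nat.zero_le l, h⟩))

theorem isSpanningLinkage_standard (hk : 0 < k) :
    IsSpanningLinkage (host k m 0) (standard k m) := by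
  refine ⟨standard_le_host, fun C => ?_⟩
  induction C using SimpleGraph.ConnectedComponent.ind with
  | h v =>
    obtain ⟨j, s, -, h2, h3⟩ := exists_source_reachable v
    refine isPathGraph_of_degree_le_two (SimpleGraph.ConnectedComponent.connected_toSimpleGraph _)
      ⟨s, SimpleGraph.ConnectedComponent.sound h3⟩ ?_ ?_
    · rintro ⟨a, _⟩ ⟨b, _⟩ ha hb
      exact Subtype.ext (IsTerminal.adj_unique hk ⟨j, Or.inl h2⟩ ha hb)
    · rintro ⟨v, _⟩ ⟨a, _⟩ ⟨b, _⟩ ⟨c, _⟩ ha hb hc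
      simp only [Subtype.mk.injEq]
      exact standard_degree_le_two (v := v) ha hb hc

theorem mem_pattern_standard (hm : 1 < m) (hk : 0 < k) {j : ℕ} {s t : Vert k m}
    (hs : IsSource j s) (ht : IsTarget j t) : s(s, t) ∈ pattern (standard k m) := by
  refine ⟨s, t, ?_, isEnd_standard hm hk ⟨j, Or.inl hs⟩, isEnd_standard hm hk ⟨j, Or.inr ht⟩,
    reachable_source_target j hs ht, rfl⟩
  rintro rfl
  have := Nat.two_pow_pos j
  unfold IsSource at hs
  unfold IsTarget at ht
  omega

theorem isVitalLinkage_standard (hm : 1 < m) (hk : 0 < k) :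
    IsVitalLinkage (host k m 0) (standard k m) := by
  refine ⟨isSpanningLinkage_standard hk, fun Q hQ hpat => ?_⟩
  have hpair : ∀ {s t : Vert k m}, s(s, t) ∈ pattern Q →
      s ≠ t ∧ IsEnd Q s ∧ IsEnd Q t ∧ Q.Reachable s t := by
    rintro s t ⟨u, v, h1, h2, h3, h4, h5⟩
    rcases Sym2.eq_iff.1 h5 with ⟨rfl, rfl⟩ | ⟨rfl, rfl⟩
    · exact ⟨h1, h2, h3, h4⟩
    · exact ⟨h1.symm, h3, h2, h4.symm⟩
  have hpat' : ∀ {s t : Vert k m}, s(s, t) ∈ pattern (standard k m) →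
      (standard k m).Reachable s t := by
    rintro s t ⟨u, v, h1, h2, h3, h4, h5⟩
    rcases Sym2.eq_iff.1 h5 with ⟨rfl, rfl⟩ | ⟨rfl, rfl⟩
    · exact h4
    · exact h4.symm
  have hST : ∀ j, ∀ s t : Vert k m, IsSource j s → IsTarget j t →
      s ≠ t ∧ IsEnd Q s ∧ IsEnd Q t ∧ Q.Reachable s t := fun j s t hs ht =>
    hpair (hpat ▸ mem_pattern_standard hm hk hs ht)
  have hm0 : 0 < m := by omega
  have hT : ∀ j, j < k → ∃ t : Vert k m, IsTarget j t := by
    intro j hj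
    have := Nat.two_pow_pos j
    rcases (Nat.succ_le_of_lt hj).eq_or_lt with h | h
    · exact ⟨⟨(2 ^ j, m - 1), this, Nat.pow_lt_pow_right (by norm_num) hj,
        Nat.sub_lt hm0 one_pos⟩, Or.inr ⟨h, rfl, Nat.sub_add_cancel (show 1 ≤ m from hm0)⟩⟩
    · have h1 : 2 ^ (j + 2) ≤ 2 ^ k := Nat.pow_le_pow_right (by norm_num) h
      rw [pow_succ, pow_succ] at h1
      exact ⟨⟨(3 * 2 ^ j, 0), by dsimp only; omega, by dsimp only; omega, hm0⟩,
        Or.inl ⟨h, rfl, rfl⟩⟩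
  have hlt : ∀ {j} {s : Vert k m}, IsSource j s → j < k := fun {j s} hs =>
    (Nat.pow_lt_pow_iff_right (by norm_num)).1 (hs.1.symm.trans_lt s.2.2.1)
  have hS : ∀ {j} {s : Vert k m}, IsSource j s → IsEnd Q s := by
    intro j s hs
    obtain ⟨t, ht⟩ := hT j (hlt hs)
    exact (hST j s t hs ht).2.1
  have hend : ∀ {v : Vert k m}, IsTerminal v → IsEnd Q v := by
    rintro v ⟨j, hs | ht⟩
    · exact hS hs
    · have hj : j < k := by
        unfold IsTarget at ht
        omega
      exact (hST j ⟨(2 ^ j, 0), Nat.two_pow_pos _, Nat.pow_lt_pow_right (by norm_num) hj, hm0⟩ v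
        ⟨rfl, rfl⟩ ht).2.2.1
  -- Two distinct sources joined in `Q` would be paired in its pattern, hence joined in the standard
  -- linkage.
  have hle : standard k m ≤ Q := by
    refine standard_le hm hk hQ.1 (fun j s t hs ht => (hST j s t hs ht).2.2.2) ?_
    intro i j s t hs ht h
    by_contra hne
    have h1 : s(s, t) ∈ pattern Q := ⟨s, t, hne, hS hs, hS ht, h, rfl⟩
    rw [hpat] at h1
    have h2 := source_unique hs ht (hpat' h1)
    subst h2
    exact hne (Vert.ext_iff'.2 ⟨hs.1.trans ht.1.symm, hs.2.trans ht.2.symm⟩)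
  -- Terminals have degree 1 in both linkages; elsewhere the standard linkage already attains the
  -- maximum degree two.
  refine le_antisymm (fun v x hx => ?_) hle
  by_cases hv : IsTerminal v
  · obtain ⟨y, hy⟩ := Set.ncard_eq_one.1 (hend hv)
    obtain ⟨z, hz⟩ := Set.ncard_eq_one.1 (isEnd_standard hm hk hv)
    have hz' : (standard k m).Adj v z := by
      have : z ∈ (standard k m).neighborSet v := hz ▸ Set.mem_singleton z
      exact this
    have h1 : x ∈ Q.neighborSet v := hx
    have h2 : z ∈ Q.neighborSet v := hle hz'
    rw [hy, Set.mem_singleton_iff] at h1 h2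
    rw [h1, ← h2]
    exact hz'
  · obtain ⟨a, b, hab, ha, hb⟩ := exists_adj_ne hm hk hv
    rcases hQ.degree_le_two (hle ha) (hle hb) hx with h | h | h
    · exact (hab h).elim
    · exact h ▸ ha
    · exact h ▸ hb

theorem hasVitalLinkage_host (hm : 1 < m) (hk : 0 < k) : HasVitalLinkage (host k m 0) k :=
  ⟨standard k m, isVitalLinkage_standard hm hk, card_components hm⟩

end Standard

/-! ### Brambles and the Helly property. -/

section Bramble

theorem mem_support_of_isPath {ι : Type*} {T : SimpleGraph ι} (hT : T.IsAcyclic) {i l j : ι}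
    {p : T.Walk i l} (hp : p.IsPath) (q : T.Walk i l) (hj : j ∈ p.support) : j ∈ q.support := by
  classical
  have h := (hT.subsingleton_path i l).elim ⟨p, hp⟩ ⟨q.bypass, q.bypass_isPath⟩
  rw [Subtype.mk.injEq] at h
  rw [h] at hj
  exact q.support_bypass_subset_support hj

/-- A path in a tree from the root to a point of a subtree enters the subtree at the point closest
to the root. -/
theorem exists_isPath_append {ι : Type*} {T : SimpleGraph ι} (hT : T.IsTree) {S : Set ι}
    (hS : ∀ i l, i ∈ S → l ∈ S → ∀ p : T.Walk i l, p.IsPath → ∀ j ∈ p.support, j ∈ S)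
    {r x y : ι} (hx : x ∈ S) (hmin : ∀ z ∈ S, T.dist r x ≤ T.dist r z) (hy : y ∈ S) :
    ∃ (p : T.Walk r x) (q : T.Walk x y), p.length = T.dist r x ∧ (∀ z ∈ q.support, z ∈ S) ∧
      (p.append q).IsPath := by
  classical
  obtain ⟨p, hp⟩ := hT.connected.exists_walk_length_eq_dist r x
  obtain ⟨q, hq, -⟩ := hT.existsUnique_path x y
  have hqS := hS x y hx hy q hq
  refine ⟨p, q, hp, hqS, ?_⟩
  have hp' := p.isPath_of_length_eq_dist hp
  rw [SimpleGraph.Walk.isPath_def] at hp' hq ⊢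
  rw [SimpleGraph.Walk.support_append]
  have hq' := hq
  rw [← q.cons_tail_support, List.nodup_cons] at hq'
  refine List.nodup_append'.2 ⟨hp', hq'.2, fun z hz hz' => ?_⟩
  have hzx : z ≠ x := by
    rintro rfl
    exact hq'.1 hz'
  -- A repeated vertex `z ≠ x` would be a point of `S` closer to `r` than `x`.
  have h1 := hmin z (hqS z (List.mem_of_mem_tail hz'))
  have h2 := SimpleGraph.dist_le (p.takeUntil z hz)
  have h3 := SimpleGraph.Walk.length_takeUntil_lt_length hz hzx
  omega

/-- The Helly property of subtrees of a tree. -/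
theorem exists_mem_of_pairwise_inter {ι β : Type*} [Finite ι] [Nonempty β] {T : SimpleGraph ι}
    (hT : T.IsTree) (S : β → Set ι)
    (hS : ∀ b i l, i ∈ S b → l ∈ S b → ∀ p : T.Walk i l, p.IsPath → ∀ j ∈ p.support, j ∈ S b)
    (hint : ∀ b b', (S b ∩ S b').Nonempty) : ∃ t, ∀ b, t ∈ S b := by
  classical
  obtain ⟨r⟩ := hT.connected.nonempty
  have hmin : ∀ b, ∃ x ∈ S b, ∀ z ∈ S b, T.dist r x ≤ T.dist r z := fun b =>
    Set.exists_min_image (S b) (T.dist r) (Set.toFinite _) ((hint b b).mono Set.inter_subset_left)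
  choose x hx hxmin using hmin
  -- Take the subtree whose entry point is farthest from the root. The path to a common vertex of `S
  -- b` and `S b₀` passes through both entry points, and that of `b₀` is not before that of `b`, so
  -- it lies in `S b`.
  obtain ⟨_, ⟨b₀, rfl⟩, hb₀⟩ := Set.exists_max_image (Set.range x) (T.dist r) (Set.toFinite _)
    (Set.range_nonempty x)
  refine ⟨x b₀, fun b => ?_⟩
  obtain ⟨y, hy, hy₀⟩ := hint b b₀
  obtain ⟨p, q, hp, hq, hpq⟩ := exists_isPath_append hT (hS b) (hx b) (hxmin b) hy
  obtain ⟨p₀, q₀, -, -, hpq₀⟩ := exists_isPath_append hT (hS b₀) (hx b₀) (hxmin b₀) hy₀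
  have hmem : x b₀ ∈ (p.append q).support :=
    mem_support_of_isPath hT.isAcyclic hpq₀ _
      ((SimpleGraph.Walk.mem_support_append_iff _ _).2 (Or.inl p₀.end_mem_support))
  rcases (SimpleGraph.Walk.mem_support_append_iff _ _).1 hmem with h | h
  · by_cases e : x b₀ = x b
    · rw [e]
      exact hx b
    · have h1 := SimpleGraph.dist_le (p.takeUntil _ h)
      have h2 := SimpleGraph.Walk.length_takeUntil_lt_length h e
      have h3 := hb₀ (x b) ⟨b, rfl⟩
      omega
  · exact hq _ h

/-- Any two vertices of the set are joined by a walk inside the set. -/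
def WalkConnected {V : Type*} (G : SimpleGraph V) (S : Set V) : Prop :=
  ∀ u v, u ∈ S → v ∈ S → ∃ p : G.Walk u v, ∀ x ∈ p.support, x ∈ S

theorem walkConnected_of_center {V : Type*} {G : SimpleGraph V} {S : Set V} {w : V}
    (h : ∀ u ∈ S, ∃ p : G.Walk u w, ∀ x ∈ p.support, x ∈ S) : WalkConnected G S := by
  intro u v hu hv
  obtain ⟨p, hp⟩ := h u hu
  obtain ⟨q, hq⟩ := h v hv
  refine ⟨p.append q.reverse, fun x hx => ?_⟩
  rcases (SimpleGraph.Walk.mem_support_append_iff _ _).1 hx with hx | hx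
  · exact hp x hx
  · rw [SimpleGraph.Walk.support_reverse, List.mem_reverse] at hx
    exact hq x hx

/-- Follow the walk through bags containing its successive edges; the resulting walk in the tree
covers the path `p`. -/
theorem TreeDecomposition.exists_mem_bag_of_walk {V : Type*} {G : SimpleGraph V} {ι : Type}
    (D : TreeDecomposition G ι) {u v : V} (w : G.Walk u v) {i l j : ι} (hi : u ∈ D.bag i)
    (hl : v ∈ D.bag l) (p : D.tree.Walk i l) (hp : p.IsPath) (hj : j ∈ p.support) :
    ∃ x ∈ w.support, x ∈ D.bag j := by
  classical
  induction w generalizing i with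
  | nil => exact ⟨_, by simp, D.inter_subset i j l p hp hj ⟨hi, hl⟩⟩
  | @cons u u' v h w ih =>
    obtain ⟨s, hs, hs'⟩ := D.edge_mem _ _ h
    obtain ⟨p₁, hp₁, -⟩ := D.isTree.existsUnique_path i s
    obtain ⟨p₂, hp₂, -⟩ := D.isTree.existsUnique_path s l
    have hmem := mem_support_of_isPath D.isTree.isAcyclic hp (p₁.append p₂) hj
    rcases (SimpleGraph.Walk.mem_support_append_iff _ _).1 hmem with h1 | h1
    · exact ⟨u, by simp, D.inter_subset i j s p₁ hp₁ h1 ⟨hi, hs⟩⟩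
    · obtain ⟨x, hx, hx'⟩ := ih hs' hl p₂ hp₂ h1
      exact ⟨x, by simp [hx], hx'⟩

/-- Some bag of a tree-decomposition meets all elements of a bramble. -/
theorem TreeDecomposition.exists_bag_of_bramble {V : Type*} {G : SimpleGraph V} {ι : Type}
    (D : TreeDecomposition G ι) {β : Type*} [Nonempty β] (B : β → Set V)
    (hB : ∀ b, WalkConnected G (B b))
    (htouch : ∀ b b', ∃ u ∈ B b, ∃ v ∈ B b', u = v ∨ G.Adj u v) :
    ∃ t, ∀ b, ∃ x ∈ B b, x ∈ D.bag t := by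
  have := D.finite
  refine exists_mem_of_pairwise_inter D.isTree (fun b => {t | ∃ x ∈ B b, x ∈ D.bag t}) ?_ ?_
  · rintro b i l ⟨u, hu, hui⟩ ⟨v, hv, hvl⟩ p hp j hj
    obtain ⟨w, hw⟩ := hB b u v hu hv
    obtain ⟨x, hx, hxj⟩ := D.exists_mem_bag_of_walk w hui hvl p hp hj
    exact ⟨x, hw x hx, hxj⟩
  · intro b b'
    obtain ⟨u, hu, v, hv, rfl | h⟩ := htouch b b'
    · obtain ⟨t, ht⟩ := D.vertex_mem u
      exact ⟨t, ⟨u, hu, ht⟩, ⟨u, hv, ht⟩⟩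
    · obtain ⟨t, ht, ht'⟩ := D.edge_mem u v h
      exact ⟨t, ⟨u, hu, ht⟩, ⟨v, hv, ht'⟩⟩

end Bramble

/-! ### Tree-width of the grid. -/

section Grid
variable {k m : ℕ}

theorem host_adj_of_hor {l : ℕ} {x y : Vert k m} (h : Hor x y) : (host k m l).Adj x y :=
  ⟨fun e => by rw [e, Hor] at h; omega, Or.inl (Or.inl h)⟩

theorem host_adj_of_ver {l : ℕ} {x y : Vert k m} (h : Ver x y) : (host k m l).Adj x y :=
  ⟨fun e => by rw [e, Ver] at h; omega, Or.inl (Or.inr (Or.inl h))⟩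

theorem exists_row_walk {l : ℕ} {u v : Vert k m} (h : u.row = v.row) :
    ∃ p : (host k m l).Walk u v, ∀ x ∈ p.support,
      x.row = u.row ∧ (x.col ≤ u.col ∨ x.col ≤ v.col) := by
  have key : ∀ n, ∀ u v : Vert k m, u.row = v.row → u.col + n = v.col →
      ∃ p : (host k m l).Walk u v, ∀ x ∈ p.support, x.row = u.row ∧ x.col ≤ v.col := by
    intro n
    induction n with
    | zero =>
      intro u v h1 h2
      obtain rfl : u = v := Vert.ext_iff'.2 ⟨h1, h2⟩
      exact ⟨SimpleGraph.Walk.nil, by simp⟩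
    | succ n ih =>
      intro u v h1 h2
      have hv := v.2.2.2
      let c : Vert k m := ⟨(u.row, u.col + 1), u.2.1, u.2.2.1, by
        dsimp only [Vert.col] at *; omega⟩
      obtain ⟨p, hp⟩ := ih c v h1 (by change u.col + 1 + n = _; omega)
      refine ⟨SimpleGraph.Walk.cons (host_adj_of_hor (⟨rfl, rfl⟩ : Hor u c)) p, fun x hx => ?_⟩
      rw [SimpleGraph.Walk.support_cons, List.mem_cons] at hx
      rcases hx with rfl | hx
      · exact ⟨rfl, by omega⟩
      · exact hp x hx
  rcases le_total u.col v.col with h' | h'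
  · obtain ⟨p, hp⟩ := key (v.col - u.col) u v h (by omega)
    exact ⟨p, fun x hx => ⟨(hp x hx).1, Or.inr (hp x hx).2⟩⟩
  · obtain ⟨p, hp⟩ := key (u.col - v.col) v u h.symm (by omega)
    refine ⟨p.reverse, fun x hx => ?_⟩
    rw [SimpleGraph.Walk.support_reverse, List.mem_reverse] at hx
    exact ⟨(hp x hx).1.trans h.symm, Or.inl (hp x hx).2⟩

theorem exists_col_walk {l : ℕ} {u v : Vert k m} (h : u.col = v.col) :
    ∃ p : (host k m l).Walk u v, ∀ x ∈ p.support,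
      x.col = u.col ∧ (x.row ≤ u.row ∨ x.row ≤ v.row) := by
  have key : ∀ n, ∀ u v : Vert k m, u.col = v.col → u.row + n = v.row →
      ∃ p : (host k m l).Walk u v, ∀ x ∈ p.support, x.col = u.col ∧ x.row ≤ v.row := by
    intro n
    induction n with
    | zero =>
      intro u v h1 h2
      obtain rfl : u = v := Vert.ext_iff'.2 ⟨h2, h1⟩
      exact ⟨SimpleGraph.Walk.nil, by simp⟩
    | succ n ih =>
      intro u v h1 h2
      have hv := v.2.2.1
      let c : Vert k m := ⟨(u.row + 1, u.col), Nat.succ_pos _, by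
        dsimp only [Vert.row] at *; omega, u.2.2.2⟩
      obtain ⟨p, hp⟩ := ih c v h1 (by change u.row + 1 + n = _; omega)
      refine ⟨SimpleGraph.Walk.cons (host_adj_of_ver (⟨rfl, rfl⟩ : Ver u c)) p, fun x hx => ?_⟩
      rw [SimpleGraph.Walk.support_cons, List.mem_cons] at hx
      rcases hx with rfl | hx
      · exact ⟨rfl, by omega⟩
      · exact hp x hx
  rcases le_total u.row v.row with h' | h'
  · obtain ⟨p, hp⟩ := key (v.row - u.row) u v h (by omega)
    exact ⟨p, fun x hx => ⟨(hp x hx).1, Or.inr (hp x hx).2⟩⟩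
  · obtain ⟨p, hp⟩ := key (u.row - v.row) v u h.symm (by omega)
    refine ⟨p.reverse, fun x hx => ?_⟩
    rw [SimpleGraph.Walk.support_reverse, List.mem_reverse] at hx
    exact ⟨(hp x hx).1.trans h.symm, Or.inl (hp x hx).2⟩

/-- The last row. -/
def bottomRow (k m : ℕ) : Set (Vert k m) := {v | v.row + 1 = 2 ^ k}

/-- The last column without its vertex in the last row. -/
def rightColumn (k m : ℕ) : Set (Vert k m) := {v | v.row + 1 < 2 ^ k ∧ v.col + 1 = m}

/-- The row and the column of a vertex, without the last row and column of the grid. -/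
def cross {k m : ℕ} (w : Vert k m) : Set (Vert k m) :=
  {v | v.row + 1 < 2 ^ k ∧ v.col + 1 < m ∧ (v.row = w.row ∨ v.col = w.col)}

/-- A bramble of the grid. -/
def IsBrambleSet (S : Set (Vert k m)) : Prop :=
  S = bottomRow k m ∨ S = rightColumn k m ∨
    ∃ w : Vert k m, w.row + 1 < 2 ^ k ∧ w.col + 1 < m ∧ S = cross w

theorem IsBrambleSet.walkConnected {l : ℕ} {S : Set (Vert k m)} (h : IsBrambleSet S) :
    WalkConnected (host k m l) S := by
  rcases h with rfl | rfl | ⟨w, h1, h2, rfl⟩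
  · intro u v hu hv
    obtain ⟨p, hp⟩ := exists_row_walk (l := l) (Nat.succ_injective (hu.trans hv.symm) : u.row = v.row)
    exact ⟨p, fun x hx => by rw [bottomRow, Set.mem_ofPred_eq, (hp x hx).1]; exact hu⟩
  · intro u v hu hv
    obtain ⟨p, hp⟩ := exists_col_walk (l := l)
      (Nat.succ_injective (hu.2.trans hv.2.symm) : u.col = v.col)
    refine ⟨p, fun x hx => ⟨?_, ?_⟩⟩
    · have := (hp x hx).2
      have := hu.1
      have := hv.1
      omega
    · rw [(hp x hx).1]
      exact hu.2
  · refine walkConnected_of_center (w := w) fun u hu => ?_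
    obtain ⟨hu1, hu2, hu3⟩ := hu
    rcases hu3 with hu3 | hu3
    · obtain ⟨p, hp⟩ := exists_row_walk (l := l) hu3
      exact ⟨p, fun x hx => by have := hp x hx; exact ⟨by omega, by omega, Or.inl (by omega)⟩⟩
    · obtain ⟨p, hp⟩ := exists_col_walk (l := l) hu3
      exact ⟨p, fun x hx => by have := hp x hx; exact ⟨by omega, by omega, Or.inr (by omega)⟩⟩

theorem IsBrambleSet.touch {l : ℕ} (hm : 1 < m) (hk : 2 ≤ k) {S S' : Set (Vert k m)}
    (h : IsBrambleSet S) (h' : IsBrambleSet S') :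
    ∃ u ∈ S, ∃ v ∈ S', u = v ∨ (host k m l).Adj u v := by
  have h4 : 2 ^ 2 ≤ 2 ^ k := Nat.pow_le_pow_right (by norm_num) hk
  have hmk : ∀ r c, 0 < r → r < 2 ^ k → c < m → ∃ x : Vert k m, x.row = r ∧ x.col = c :=
    fun r c h1 h2 h3 => ⟨⟨(r, c), h1, h2, h3⟩, rfl, rfl⟩
  have hsymm : ∀ {A B : Set (Vert k m)}, (∃ u ∈ A, ∃ v ∈ B, u = v ∨ (host k m l).Adj u v) →
      ∃ u ∈ B, ∃ v ∈ A, u = v ∨ (host k m l).Adj u v := fun ⟨u, hu, v, hv, h⟩ =>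
    ⟨v, hv, u, hu, h.imp Eq.symm SimpleGraph.Adj.symm⟩
  have hself : ∀ {A : Set (Vert k m)} (x), x ∈ A →
      ∃ u ∈ A, ∃ v ∈ A, u = v ∨ (host k m l).Adj u v := fun x hx =>
    ⟨x, hx, x, hx, Or.inl rfl⟩
  have hbr : ∃ u ∈ bottomRow k m, ∃ v ∈ rightColumn k m, u = v ∨ (host k m l).Adj u v := by
    obtain ⟨u, hu1, hu2⟩ := hmk (2 ^ k - 1) (m - 1) (by omega) (by omega) (by omega)
    obtain ⟨v, hv1, hv2⟩ := hmk (2 ^ k - 2) (m - 1) (by omega) (by omega) (by omega)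
    refine ⟨u, ?_, v, ⟨?_, ?_⟩, Or.inr (host_adj_of_ver ⟨?_, ?_⟩).symm⟩
    · change u.row + 1 = 2 ^ k
      omega
    all_goals omega
  have hbc : ∀ w : Vert k m, w.col + 1 < m →
      ∃ u ∈ bottomRow k m, ∃ v ∈ cross w, u = v ∨ (host k m l).Adj u v := by
    intro w hw
    obtain ⟨u, hu1, hu2⟩ := hmk (2 ^ k - 1) w.col (by omega) (by omega) (by omega)
    obtain ⟨v, hv1, hv2⟩ := hmk (2 ^ k - 2) w.col (by omega) (by omega) (by omega)
    refine ⟨u, ?_, v, ⟨?_, ?_, Or.inr hv2⟩, Or.inr (host_adj_of_ver ⟨?_, ?_⟩).symm⟩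
    · change u.row + 1 = 2 ^ k
      omega
    all_goals omega
  have hrc : ∀ w : Vert k m, w.row + 1 < 2 ^ k →
      ∃ u ∈ rightColumn k m, ∃ v ∈ cross w, u = v ∨ (host k m l).Adj u v := by
    intro w hw
    have hw0 : 0 < w.row := w.2.1
    obtain ⟨u, hu1, hu2⟩ := hmk w.row (m - 1) (by omega) (by omega) (by omega)
    obtain ⟨v, hv1, hv2⟩ := hmk w.row (m - 2) (by omega) (by omega) (by omega)
    refine ⟨u, ⟨?_, ?_⟩, v, ⟨?_, ?_, Or.inl hv1⟩, Or.inr (host_adj_of_hor ⟨?_, ?_⟩).symm⟩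
    all_goals omega
  rcases h with rfl | rfl | ⟨w, h1, h2, rfl⟩ <;> rcases h' with rfl | rfl | ⟨w', h1', h2', rfl⟩
  · obtain ⟨u, hu, -⟩ := hbr
    exact hself u hu
  · exact hbr
  · exact hbc w' h2'
  · exact hsymm hbr
  · obtain ⟨-, -, u, hu, -⟩ := hbr
    exact hself u hu
  · exact hrc w' h1'
  · exact hsymm (hbc w h2)
  · exact hsymm (hrc w h1)
  · obtain ⟨u, hu1, hu2⟩ := hmk w.row w'.col w.2.1 w.2.2.1 w'.2.2.2
    exact ⟨u, ⟨by omega, by omega, Or.inl hu1⟩, u, ⟨by omega, by omega, Or.inr hu2⟩, Or.inl rfl⟩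

/-- The grid with `2 ^ k - 1` rows and at least as many columns has tree-width at least
`2 ^ k - 1`. -/
theorem le_width_host {l : ℕ} (hk : 2 ≤ k) (hm : 2 ^ k ≤ m + 1) {ι : Type}
    (D : TreeDecomposition (host k m l) ι) {w : ℕ} (hw : D.WidthLE w) : 2 ^ k ≤ w + 1 := by
  have h4 : 2 ^ 2 ≤ 2 ^ k := Nat.pow_le_pow_right (by norm_num) hk
  have hm1 : 1 < m := by omega
  have hne : Nonempty {S : Set (Vert k m) // IsBrambleSet S} := ⟨⟨_, Or.inl rfl⟩⟩
  obtain ⟨t, ht⟩ := D.exists_bag_of_bramble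
    (fun S : {S : Set (Vert k m) // IsBrambleSet S} => S.1) (fun S => S.2.walkConnected)
    (fun S S' => S.2.touch hm1 hk S'.2)
  obtain ⟨hfin, hcard⟩ := hw t
  obtain ⟨b, hb, hbt⟩ := ht ⟨_, Or.inl rfl⟩
  obtain ⟨r, hr, hrt⟩ := ht ⟨_, Or.inr (Or.inl rfl)⟩
  by_contra hlt
  -- The bag spends one vertex on the last row and one on the right column. If it has fewer than `2
  -- ^ k` vertices, at most `2 ^ k - 3` remain, too few to meet all `2 ^ k - 2` other rows or all `m
  -- - 1` other columns; so some cross is missed.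
  set X : Set (Vert k m) := D.bag t ∩ {v | v.row + 1 < 2 ^ k ∧ v.col + 1 < m} with hX
  have hXfin : X.Finite := hfin.subset Set.inter_subset_left
  have hbX : b ∉ X := by
    intro h
    have h1 : b.row + 1 = 2 ^ k := hb
    have h2 : b.row + 1 < 2 ^ k := h.2.1
    omega
  have hrX : r ∉ insert b X := by
    rintro (rfl | h)
    · have h1 : r.row + 1 = 2 ^ k := hb
      have h2 : r.row + 1 < 2 ^ k := hr.1
      omega
    · have h1 : r.col + 1 = m := hr.2
      have h2 : r.col + 1 < m := h.2.2
      omega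
  have hXcard : X.ncard + 2 ≤ (D.bag t).ncard := by
    have h1 := Set.ncard_insert_of_notMem hbX hXfin
    have h2 := Set.ncard_insert_of_notMem hrX (hXfin.insert b)
    have h3 : insert r (insert b X) ⊆ D.bag t :=
      Set.insert_subset hrt (Set.insert_subset hbt Set.inter_subset_left)
    have h4 := Set.ncard_le_ncard h3 hfin
    omega
  have hrow : ∃ i ∈ Set.Ioo 0 (2 ^ k - 1), i ∉ Vert.row '' X := by
    refine Set.exists_mem_notMem_of_ncard_lt_ncard ?_ (hXfin.image _)
    have h1 := Set.ncard_image_le (f := Vert.row) hXfin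
    have h2 : (Set.Ioo 0 (2 ^ k - 1)).ncard = 2 ^ k - 1 - 0 - 1 := by
      rw [Set.ncard_eq_toFinset_card', Set.toFinset_Ioo, Nat.card_Ioo]
    omega
  have hcol : ∃ c ∈ Set.Iio (m - 1), c ∉ Vert.col '' X := by
    refine Set.exists_mem_notMem_of_ncard_lt_ncard ?_ (hXfin.image _)
    have h1 := Set.ncard_image_le (f := Vert.col) hXfin
    have h2 : (Set.Iio (m - 1)).ncard = m - 1 := by
      rw [Set.ncard_eq_toFinset_card', Set.toFinset_Iio, Nat.card_Iio]
    omega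
  obtain ⟨i, ⟨hi0, hi⟩, hiX⟩ := hrow
  obtain ⟨c, hc, hcX⟩ := hcol
  rw [Set.mem_Iio] at hc
  let z : Vert k m := ⟨(i, c), hi0, by dsimp only; omega, by dsimp only; omega⟩
  obtain ⟨x, hx, hxt⟩ := ht ⟨cross z, Or.inr (Or.inr ⟨z, by change i + 1 < _; omega,
    by change c + 1 < _; omega, rfl⟩)⟩
  have hxX : x ∈ X := ⟨hxt, hx.1, hx.2.1⟩
  rcases hx.2.2 with h | h
  · exact hiX ⟨x, hxX, h⟩
  · exact hcX ⟨x, hxX, h⟩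

end Grid

/-! ### Conclusion. -/

theorem exists_graph_le_width {k : ℕ} (hk : 2 ≤ k) :
    ∃ (V : Type) (_ : Finite V) (G : SimpleGraph V), HasVitalLinkage G k ∧
      2 ^ k ≤ treeWidth G + 1 ∧ 2 ^ k ≤ pathWidth G + 1 := by
  refine ⟨Vert k (2 ^ k), inferInstance, host k (2 ^ k) 0,
    hasVitalLinkage_host (Nat.one_lt_two_pow (by omega)) (by omega), ?_, ?_⟩
  -- The infimum over an empty set would be 0, so attainment needs some decomposition.
  · have h : treeWidth (host k (2 ^ k) 0) ∈ _ := Nat.sInf_mem (by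
      obtain ⟨w, ι, D, -, hw⟩ := exists_pathDecomposition (host k (2 ^ k) 0)
      exact ⟨w, ι, D, hw⟩)
    obtain ⟨ι, D, hw⟩ := h
    exact le_width_host hk (Nat.le_succ _) D hw
  · have h : pathWidth (host k (2 ^ k) 0) ∈ _ :=
      Nat.sInf_mem (exists_pathDecomposition (host k (2 ^ k) 0))
    obtain ⟨ι, D, -, hw⟩ := h
    exact le_width_host hk (Nat.le_succ _) D hw

end VitalLinkage

theorem mainTheorem3 (f g : ℕ → ℕ)
    (hfg : ∀ (k : ℕ) (V : Type) [Finite V] (G : SimpleGraph V),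
      VitalLinkage.HasVitalLinkage G k →
        VitalLinkage.treeWidth G ≤ f k ∧ VitalLinkage.pathWidth G ≤ g k)
    (k : ℕ) (hk : 2 ≤ k) :
    2 ^ (k - 1) + 1 ≤ f k ∧ 2 ^ (k - 1) + 1 ≤ g k := by
  obtain ⟨V, hV, G, hG, ht, hp⟩ := VitalLinkage.exists_graph_le_width hk
  obtain ⟨h1, h2⟩ := hfg k V G hG
  -- It remains that `2 ^ k - 1 ≥ 2 ^ (k - 1) + 1`, which holds as `2 ^ (k - 1) ≥ 2`.
  obtain ⟨j, rfl⟩ := Nat.exists_eq_add_of_le' hk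
  have h3 : 0 < 2 ^ j := Nat.two_pow_pos j
  rw [show j + 2 - 1 = j + 1 from rfl, pow_succ]
  rw [pow_succ, pow_succ] at ht hp
  omega
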